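/- **The framework.** CoLF$^\omega$ is the dependently typed logical framework whose terms are infinitary $\beta$-normal $\eta$-long terms stratified by observation depth. For $k\ge 0$, terms of depth $k+1$ are given by $$M_{(k+1)} ::= \lambda x.\,M_{(k+1)} \mid x\cdot(M^1_{(k+1)};\dots;M^n_{(k+1)}) \mid c\cdot(M^1_{(k)};\dots;M^n_{(k)}),$$ where $x$ is a variable and $c$ a constant, and the only term of depth $0$ is the unobservable one. A term $M=M_{(\omega)}$ is a coherent family $(M_{(k)})_{k}$ of observations of all finite depths. Atomic types are $a\cdot(M^1;\dots;M^n)$ with $a$ a type family; in a type of depth $k+1$ the terms have depth $k$. The judgments $\Gamma_{(k)}\vdash_{\Sigma_{(k)}}M_{(k)}\Leftarrow A_{(k)}$ are those of canonical LF (with hereditary substitution, computed at depth $k$), relative to the depth-$k$ expansion $\Sigma_{(k)}$ of a finitary signature $\Sigma$ in which recursive definitions $r:A=M$ are unfolded; at depth $0$ they hold trivially, and in checking $c\cdot(M^1_{(k)};\dots;M^n_{(k)})$ at depth $k+1$ the arguments are checked at depth $k$. An infinitary term is *trace-valid* if along each of its infinite traces (sequences of heads along an infinite path of arguments) some coinductive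 constructor occurs infinitely often and has a priority at least that of every constructor occurring infinitely often; the priority of a constructor is the position in $\Sigma$ of the declaration of its type family. A *canonical term* of type $a\cdot(M^1;\dots;M^n)$ is a trace-valid infinitary term $M$ with $\cdot\vdash_{\Sigma_{(k)}}M_{(k)}\Leftarrow a\cdot(M^1_{(k-1)};\dots;M^n_{(k-1)})$ for all $k\geq1$. **The signature** $\Sigma$ is the following, in this order (capital letters are implicitly $\Pi$-quantified in each declaration, and are explicit arguments in terms): ``` conat : cotype. cozero : conat. cosucc : conat -> conat. cobin : cotype. b0 : cobin -> cobin. b1 : cobin -> cobin. bzero : cobin = b0 bzero. bone : cobin = b1 bzero. w1 : cobin = b1 w1. w2 : cobin = b1 (b0 w2). bsucc : cobin -> cobin -> cotype. bsucc/0 : bsucc (b0 X) (b1 X). bsucc/1 : bsucc X Y -> bsucc (b1 X) (b0 Y). coplus : conat -> conat -> conat -> cotype. coplus/0 : coplus cozero Y Y. coplus/1 : coplus X Y Z -> coplus (cosucc X) Y (cosucc Z). tobin : conat -> cobin -> cotype. tobin/0 : tobin cozero bzero. tobin/1 : tobin X Y -> bsucc Y Z -> tobin (cosucc X) Z. frombin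 : cobin -> conat -> cotype. frombin/0 : frombin X Y -> coplus Y Y Z -> frombin (b0 X) Z. frombin/1 : frombin X Y -> coplus Y Y Z -> frombin (b1 X) (cosucc Z). bplus : cobin -> cobin -> cobin -> cotype. bplus/00 : bplus X Y Z -> bplus (b0 X) (b0 Y) (b0 Z). bplus/01 : bplus X Y Z -> bplus (b0 X) (b1 Y) (b1 Z). bplus/10 : bplus X Y Z -> bplus (b1 X) (b0 Y) (b1 Z). bplus/11 : bplus X Y Z -> bsucc Z W -> bplus (b1 X) (b1 Y) (b0 W). b0+0is0 : bplus bzero bzero bzero = bplus/00 b0+0is0. bsucc0is1 : bsucc bzero bone = bsucc/0. eqconat : conat -> conat -> cotype. eqconat/0 : eqconat cozero cozero. eqconat/1 : eqconat X Y -> eqconat (cosucc X) (cosucc Y). eqconat/refl : eqconat X X -> cotype. eqconat/refl/0 : eqconat/refl eqconat/0. eqconat/refl/1 : eqconat/refl EQR -> eqconat/refl (eqconat/1 EQR). bsucc_sound : {N}{M}{CN}{CM} frombin N CN -> frombin M CM -> bsucc N M -> eqconat (cosucc CN) CM -> cotype. bsucc_sound/0 : eqconat/refl EQC -> bsucc_sound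 (b0 N) (b1 N) Z (cosucc Z) (frombin/0 FB CP) (frombin/1 FB CP) bsucc/0 (eqconat/1 EQC). bsucc_sound/1 : bsucc_sound N M CN CM FN FM S EQC -> bsucc_sound (b1 N) (b0 M) (cosucc CN) (cosucc CM) (frombin/1 FN PN) (frombin/0 FM PM) (bsucc/1 S) (eqconat/1 EQC). ``` Type reconstruction gives in `bsucc_sound/0`: `FB : frombin N Y`, `CP : coplus Y Y Z`, `EQC : eqconat Z Z`; and in `bsucc_sound/1`: `FN : frombin N CN`, `FM : frombin M CM`, `S : bsucc N M`, `EQC : eqconat (cosucc CN) CM`, `PN : coplus CN CN CN`, `PM : coplus CM CM (cosucc CM)`. **The objects encoded.** A *cobinary number* is an infinite sequence $N\in\{0,1\}^{\mathbb N}$ of bits, the least significant first; its *successor* is the sequence in which the $i$-th bit is flipped if and only if all bits of $N$ before it are $1$ (binary increment). A *conatural number* is an element of $\mathbb N\cup\{\infty\}$. A *derivation* of one of the judgments $\mathrm{bsucc}(N,M)$, $\mathrm{coplus}(X,Y,Z)$, $\mathrm{frombin}(N,X)$, $\mathrm{eqconat}(X,Y)$ about cobinary and conatural numbers is a possibly infinite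 tree of instances of the inference rules with the same names as the constructors above, read with $b0,b1$ as prefixing a bit, cozero as $0$ and cosucc as $X\mapsto X+1$. Given derivations $F_N$ of $\mathrm{frombin}(N,C_N)$, $F_M$ of $\mathrm{frombin}(M,C_M)$, $S$ of $\mathrm{bsucc}(N,M)$ and $E$ of $\mathrm{eqconat}(C_N+1,C_M)$, a *derivation of the soundness of the cobinary successor* for these data is a possibly infinite tree built from the rules eqconat/refl/0, eqconat/refl/1, bsucc_sound/0, bsucc_sound/1 (read in the same way, on derivations) with conclusion $\mathrm{bsucc\_sound}(N,M,C_N,C_M,F_N,F_M,S,E)$. The encoding $\ulcorner\cdot\urcorner$ of numbers and derivations is the compositional one: digits, zero, successor and each rule are mapped to the constant of the same name, applied to the encodings of the parameters of the rule instance and of the derivations of its premises. **Theorem (Adequacy of Encoding).** 1. $N\mapsto\ulcorner N\urcorner$ is a bijection from the cobinary numbers onto the canonical terms of type $\mathtt{cobin}$. 2. For all cobinary numbers $N$ and $M$, there is a canonical term of type $\mathtt{bsucc}\,\ulcorner N\urcorner\,\ulcorner M\urcorner$ if and only if $M$ is the successor of $N$. 3. For all cobinary numbers $N,M$, conatural numbers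 $C_N,C_M$, and derivations $F_N$ of $\mathrm{frombin}(N,C_N)$, $F_M$ of $\mathrm{frombin}(M,C_M)$, $S$ of $\mathrm{bsucc}(N,M)$ and $E$ of $\mathrm{eqconat}(C_N+1,C_M)$: the encodings of $C_N$, $C_M$, $F_N$, $F_M$, $S$, $E$ are canonical terms of the corresponding types, and $D\mapsto\ulcorner D\urcorner$ is a bijection from the derivations of the soundness of the cobinary successor for these data onto the canonical terms of type $$\mathtt{bsucc\_sound}\ \ulcorner N\urcorner\ \ulcorner M\urcorner\ \ulcorner C_N\urcorner\ \ulcorner C_M\urcorner\ \ulcorner F_N\urcorner\ \ulcorner F_M\urcorner\ \ulcorner S\urcorner\ \ulcorner E\urcorner.$$ -/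

import Mathlib

namespace CoLF

/-! ### Infinitary syntax: terms of finite observation depth

Variables are de Bruijn indices.  `C` is the type of constants (constructors). -/

/-- Simple types `τ ::= * ∣ τ₁ → τ₂`. -/
inductive STy : Type
  | base : STy
  | arr : STy → STy → STy

mutual
/-- Raw terms.  `unobs` is the unobservable term of depth `0`. -/
inductive Tm (C : Type) : Type
  | unobs : Tm C
  | lam : Tm C → Tm C
  | var : ℕ → Spine C → Tm C
  | con : C → Spine C → Tm C
/-- Spines `() ∣ M ; S`. -/
inductive Spine (C : Type) : Type
  | nil : Spine C
  | cons : Tm C → Spine C → Spine C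
end

section Terms
variable {C : Type}

/-- The spine with the given list of arguments. -/
def Spine.ofList : List (Tm C) → Spine C
  | [] => .nil
  | M :: Ms => .cons M (Spine.ofList Ms)

mutual
/-- `M` is a term of observation depth exactly `k`.  The arguments of a variable are observed in the
same observation (continuing spine), those of a constant in the next one (suspended spine). -/
def Tm.HasDepth : ℕ → Tm C → Prop
  | 0, .unobs => True
  | 0, .lam _ => False
  | 0, .var _ _ => False
  | 0, .con _ _ => False
  | _ + 1, .unobs => False
  | k + 1, .lam M => Tm.HasDepth (k + 1) M
  | k + 1, .var _ T => Spine.HasDepth (k + 1) T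
  | k + 1, .con _ S => Spine.HasDepth k S
/-- Every argument of the spine has observation depth `k`. -/
def Spine.HasDepth : ℕ → Spine C → Prop
  | _, .nil => True
  | k, .cons M S => Tm.HasDepth k M ∧ Spine.HasDepth k S
end

mutual
/-- The observation of a term at depth `k`. -/
def Tm.trunc : ℕ → Tm C → Tm C
  | 0, _ => .unobs
  | _ + 1, .unobs => .unobs
  | k + 1, .lam M => .lam (Tm.trunc (k + 1) M)
  | k + 1, .var i T => .var i (Spine.trunc (k + 1) T)
  | k + 1, .con c S => .con c (Spine.trunc k S)
/-- Every argument of the spine is observed at depth `k`. -/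
def Spine.trunc : ℕ → Spine C → Spine C
  | _, .nil => .nil
  | k, .cons M S => .cons (Tm.trunc k M) (Spine.trunc k S)
end

/-- An infinitary term (of depth `ω`) is the coherent family of its observations at all finite
depths. -/
def IsInfTm (M : ℕ → Tm C) : Prop :=
  ∀ k, (M k).HasDepth k ∧ (M (k + 1)).trunc k = M k

mutual
/-- Add `n` to all the variables that are at least `d`. -/
def Tm.shift (n : ℕ) : ℕ → Tm C → Tm C
  | _, .unobs => .unobs
  | d, .lam M => .lam (Tm.shift n (d + 1) M)
  | d, .var i T => .var (if d ≤ i then i + n else i) (Spine.shift n d T)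
  | d, .con c S => .con c (Spine.shift n d S)
/-- Add `n` to all the variables that are at least `d`. -/
def Spine.shift (n : ℕ) : ℕ → Spine C → Spine C
  | _, .nil => .nil
  | d, .cons M S => .cons (Tm.shift n d M) (Spine.shift n d S)
end

/-! ### Hereditary substitution

Hereditary substitution is partial; `none` means that no clause applies.  The substituted variable
`x` is removed from the context, so larger indices are lowered by one. -/

mutual
/-- `[N/x] M` at depth `k`, for `N` and `M` of depth `k`; the argument `app` is the operation that
applies a spine to `N`. -/
def Tm.hsubWith (app : ℕ → Spine C → Tm C → Option (Tm C)) :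
    ℕ → Tm C → ℕ → Tm C → Option (Tm C)
  | 0, _, _, _ => some .unobs
  | _ + 1, _, _, .unobs => none
  | k + 1, N, x, .lam M =>
      (Tm.hsubWith app (k + 1) (N.shift 1 0) (x + 1) M).map .lam
  | k + 1, N, x, .var y T =>
      (Spine.hsubWith app (k + 1) N x T).bind fun T' =>
        if y = x then app (k + 1) T' N
        else some (.var (if x < y then y - 1 else y) T')
  | k + 1, N, x, .con c S =>
      (Spine.hsubWith app k (N.trunc k) x S).map (.con c)
/-- The substitution at depth `k` in all the arguments of a spine. -/
def Spine.hsubWith (app : ℕ → Spine C → Tm C → Option (Tm C)) :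
    ℕ → Tm C → ℕ → Spine C → Option (Spine C)
  | _, _, _, .nil => some .nil
  | k, N, x, .cons M S =>
      (Tm.hsubWith app k N x M).bind fun M' =>
        (Spine.hsubWith app k N x S).map (.cons M')
end

/-- `T ▷^τ N` at depth `k`: apply the term `N` of simple type `τ` to the continuing spine `T`. -/
def appSpine : STy → ℕ → Spine C → Tm C → Option (Tm C)
  | _, 0, _, _ => some .unobs
  | .base, _ + 1, .nil, .var i T => some (.var i T)
  | .base, _ + 1, .nil, .con c S => some (.con c S)
  | .arr τ₂ τ₁, k + 1, .cons N T, .lam M =>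
      (Tm.hsubWith (fun j T' N' => appSpine τ₂ j T' N') (k + 1) N 0 M).bind fun M' =>
        appSpine τ₁ (k + 1) T M'
  | _, _, _, _ => none

/-- `[N/x]^τ S` for a spine all of whose arguments have depth `k`. -/
def Spine.hsub (τ : STy) (k : ℕ) (N : Tm C) (x : ℕ) (S : Spine C) : Option (Spine C) :=
  Spine.hsubWith (appSpine τ) k N x S

end Terms

/-! ### Types and kinds

`F` is the type of names of type families and `S` the type of spines. -/

/-- Canonical types `A ::= a · S ∣ Π x : A. B`. -/
inductive Ty (F S : Type) : Type
  | atom : F → S → Ty F S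
  | pi : Ty F S → Ty F S → Ty F S

/-- Kinds `K ::= type ∣ cotype ∣ Π x : A. K`. -/
inductive Kind (F S : Type) : Type
  | type : Kind F S
  | cotype : Kind F S
  | pi : Ty F S → Kind F S → Kind F S

/-- Erasure of a type to a simple type. -/
def Ty.erase {F S : Type} : Ty F S → STy
  | .atom _ _ => .base
  | .pi A B => .arr A.erase B.erase

/-- The family `a` of a type `Π x₁ : A₁. … Π xₙ : Aₙ. a · S`. -/
def Ty.target {F S : Type} : Ty F S → F
  | .atom a _ => a
  | .pi _ B => B.target

/-- A kind `Π x₁ : A₁. … Π xₙ : Aₙ. cotype`. -/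
def Kind.IsCotype {F S : Type} : Kind F S → Prop
  | .type => False
  | .cotype => True
  | .pi _ K => K.IsCotype

section Types
variable {F C : Type}

/-- The observation of a type at depth `k`: the terms in a type of depth `k + 1` have depth `k`.
All judgments at depth `0` hold trivially, so the value at `k = 0` is irrelevant. -/
def Ty.trunc (k : ℕ) : Ty F (Spine C) → Ty F (Spine C)
  | .atom a S => .atom a (S.trunc (k - 1))
  | .pi A B => .pi (A.trunc k) (B.trunc k)

/-- Add `n` to all the variables that are at least `d`. -/
def Ty.shift (n : ℕ) : ℕ → Ty F (Spine C) → Ty F (Spine C)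
  | d, .atom a S => .atom a (S.shift n d)
  | d, .pi A B => .pi (A.shift n d) (B.shift n (d + 1))

/-- `[N/x]^τ A` for `N` of depth `k` and a type `A` of depth `k + 1`. -/
def Ty.hsub (τ : STy) (k : ℕ) :
    Tm C → ℕ → Ty F (Spine C) → Option (Ty F (Spine C))
  | N, x, .atom a S => (S.hsub τ k N x).map (.atom a)
  | N, x, .pi A B =>
      (A.hsub τ k N x).bind fun A' => (B.hsub τ k (N.shift 1 0) (x + 1)).map (.pi A')

end Types

/-! ### Finitary signatures and their expansion -/

mutual
/-- Finitary terms; `dfn r S` is a recursion constant `r` applied to a spine. -/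
inductive FTm (C R : Type) : Type
  | lam : FTm C R → FTm C R
  | var : ℕ → FSpine C R → FTm C R
  | con : C → FSpine C R → FTm C R
  | dfn : R → FSpine C R → FTm C R
/-- Finitary spines. -/
inductive FSpine (C R : Type) : Type
  | nil : FSpine C R
  | cons : FTm C R → FSpine C R → FSpine C R
end

/-- The finitary spine with the given list of arguments. -/
def FSpine.ofList {C R : Type} : List (FTm C R) → FSpine C R
  | [] => .nil
  | M :: Ms => .cons M (FSpine.ofList Ms)

/-- Declarations `a : K`, `c : A` and `r : A = λ x₁. … λ xₙ. c · S`.  The body of a recursive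
definition must have a constant `c` as its head. -/
inductive Decl (F C R : Type) : Type
  | fam (a : F) (K : Kind F (FSpine C R)) : Decl F C R
  | con (c : C) (A : Ty F (FSpine C R)) : Decl F C R
  | dfn (r : R) (A : Ty F (FSpine C R)) (n : ℕ) (c : C) (S : FSpine C R) : Decl F C R

/-- A finitary signature, in the order of declaration. -/
abbrev Sig (F C R : Type) : Type := List (Decl F C R)

section Signatures
variable {F C R : Type} [DecidableEq R]

/-- The definition `(A, n, c, S)` of the recursion constant `r : A = λ x₁. … λ xₙ. c · S`. -/
def Sig.body (σ : Sig F C R) (r : R) : Option (Ty F (FSpine C R) × ℕ × C × FSpine C R) :=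
  σ.findSome? fun
    | .dfn r' A n c S => if r' = r then some (A, n, c, S) else none
    | _ => none

/-- Apply `f` to all the arguments of a spine. -/
def FSpine.mapArgs (f : FTm C R → Option (Tm C)) : FSpine C R → Option (Spine C)
  | .nil => some .nil
  | .cons M S => (f M).bind fun M' => (FSpine.mapArgs f S).map (.cons M')

mutual
/-- The expansion at depth `k + 1`, given the expansion `prev` at depth `k`. -/
def FTm.expWith (σ : Sig F C R) (k : ℕ) (prev : FTm C R → Option (Tm C)) :
    FTm C R → Option (Tm C)
  | .lam M => (FTm.expWith σ k prev M).map .lam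
  | .var i S => (FSpine.expWith σ k prev S).map (.var i)
  | .con c S => (FSpine.mapArgs prev S).map (.con c)
  | .dfn r S =>
      (FSpine.expWith σ k prev S).bind fun T =>
        (σ.body r).bind fun d =>
          (FSpine.mapArgs prev d.2.2.2).bind fun S' =>
            appSpine d.1.erase (k + 1) T (Tm.lam^[d.2.1] (.con d.2.2.1 S'))
/-- The expansion into continuing spines of depth `k + 1`. -/
def FSpine.expWith (σ : Sig F C R) (k : ℕ) (prev : FTm C R → Option (Tm C)) :
    FSpine C R → Option (Spine C)
  | .nil => some .nil
  | .cons M S =>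
      (FTm.expWith σ k prev M).bind fun M' =>
        (FSpine.expWith σ k prev S).map (.cons M')
end

/-- The expansion of a finitary term at depth `k`. -/
def FTm.exp (σ : Sig F C R) : ℕ → FTm C R → Option (Tm C)
  | 0 => fun _ => some .unobs
  | k + 1 => FTm.expWith σ k (FTm.exp σ k)

/-- The expansion of a finitary type at depth `k`; its terms have depth `k - 1`. -/
def Ty.exp (σ : Sig F C R) (k : ℕ) : Ty F (FSpine C R) → Option (Ty F (Spine C))
  | .atom a S => (FSpine.mapArgs (FTm.exp σ (k - 1)) S).map (.atom a)
  | .pi A B => (A.exp σ k).bind fun A' => (B.exp σ k).map (.pi A')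

/-- The declaration `c : A` belongs to the expansion of `σ` at depth `k`. -/
def Sig.HasCon (σ : Sig F C R) (k : ℕ) (c : C) (A : Ty F (Spine C)) : Prop :=
  ∃ A₀, Decl.con c A₀ ∈ σ ∧ A₀.exp σ k = some A

/-! ### Typing judgments at depth `k` -/

mutual
/-- `Γ ⊢ M ⇐ A` at depth `k`. -/
inductive Chk (σ : Sig F C R) : ℕ → List (Ty F (Spine C)) → Tm C → Ty F (Spine C) → Prop
  | zero (Γ : List (Ty F (Spine C))) (M : Tm C) (A : Ty F (Spine C)) : Chk σ 0 Γ M A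
  | neutral (k : ℕ) (Γ : List (Ty F (Spine C))) (M : Tm C) (a a' : F) (S S' : Spine C) :
      Syn σ (k + 1) Γ M a' S' →
      Ty.trunc (k + 1) (.atom a' S') = Ty.trunc (k + 1) (.atom a S) →
      Chk σ (k + 1) Γ M (.atom a S)
  | lam (k : ℕ) (Γ : List (Ty F (Spine C))) (M : Tm C) (A B : Ty F (Spine C)) :
      Chk σ (k + 1) (B :: Γ) M A →
      Chk σ (k + 1) Γ (.lam M) (.pi B A)
/-- `Γ ⊢ R ⇒ a · S` at depth `k`. -/
inductive Syn (σ : Sig F C R) : ℕ → List (Ty F (Spine C)) → Tm C → F → Spine C → Prop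
  | zero (Γ : List (Ty F (Spine C))) (M : Tm C) (a : F) (S : Spine C) : Syn σ 0 Γ M a S
  | var (k : ℕ) (Γ : List (Ty F (Spine C))) (i : ℕ) (T : Spine C) (A : Ty F (Spine C))
      (a : F) (S : Spine C) :
      Γ[i]? = some A →
      ChkCont σ (k + 1) Γ T (A.shift (i + 1) 0) a S →
      Syn σ (k + 1) Γ (.var i T) a S
  | con (k : ℕ) (Γ : List (Ty F (Spine C))) (c : C) (S' : Spine C) (A : Ty F (Spine C))
      (a : F) (S : Spine C) :
      σ.HasCon (k + 1) c A →
      ChkSusp σ (k + 1) Γ S' A a S →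
      Syn σ (k + 1) Γ (.con c S') a S
/-- `Γ ⊢ T ▷ A ⇒ a · S` at depth `k`, for a continuing spine `T`. -/
inductive ChkCont (σ : Sig F C R) :
    ℕ → List (Ty F (Spine C)) → Spine C → Ty F (Spine C) → F → Spine C → Prop
  | zero (Γ : List (Ty F (Spine C))) (T : Spine C) (A : Ty F (Spine C)) (a : F) (S : Spine C) :
      ChkCont σ 0 Γ T A a S
  | nil (k : ℕ) (Γ : List (Ty F (Spine C))) (a : F) (S : Spine C) :
      ChkCont σ (k + 1) Γ .nil (.atom a S) a S
  | cons (k : ℕ) (Γ : List (Ty F (Spine C))) (M : Tm C) (T : Spine C) (A A' B : Ty F (Spine C))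
      (a : F) (S : Spine C) :
      Chk σ (k + 1) Γ M B →
      A.hsub B.erase k (M.trunc k) 0 = some A' →
      ChkCont σ (k + 1) Γ T A' a S →
      ChkCont σ (k + 1) Γ (.cons M T) (.pi B A) a S
/-- `Γ ⊢ S' ▷ A ⇒ a · S` at depth `k`, for a suspended spine `S'`.  Its arguments have depth one less
than the spine, and they are checked at that depth. -/
inductive ChkSusp (σ : Sig F C R) :
    ℕ → List (Ty F (Spine C)) → Spine C → Ty F (Spine C) → F → Spine C → Prop
  | zero (Γ : List (Ty F (Spine C))) (S' : Spine C) (A : Ty F (Spine C)) (a : F) (S : Spine C) :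
      ChkSusp σ 0 Γ S' A a S
  | nil (k : ℕ) (Γ : List (Ty F (Spine C))) (a : F) (S : Spine C) :
      ChkSusp σ (k + 1) Γ .nil (.atom a S) a S
  | cons (k : ℕ) (Γ : List (Ty F (Spine C))) (M : Tm C) (S' : Spine C) (A A' B : Ty F (Spine C))
      (a : F) (S : Spine C) :
      Chk σ k (Γ.map (Ty.trunc k)) M (B.trunc k) →
      A.hsub B.erase k M 0 = some A' →
      ChkSusp σ (k + 1) Γ S' A' a S →
      ChkSusp σ (k + 1) Γ (.cons M S') (.pi B A) a S
end

/-! ### Validity and canonical terms -/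

/-- Heads of terms. -/
inductive Head (C : Type) : Type
  | var : ℕ → Head C
  | con : C → Head C

mutual
/-- The head of the subterm at a given address, an address being a list of argument positions. -/
def Tm.headAt : Tm C → List ℕ → Option (Head C)
  | .unobs, _ => none
  | .lam M, p => Tm.headAt M p
  | .var i _, [] => some (.var i)
  | .var _ T, j :: p => Spine.headAt T j p
  | .con c _, [] => some (.con c)
  | .con _ S, j :: p => Spine.headAt S j p
/-- The head of the subterm at address `p` in the argument number `j`. -/
def Spine.headAt : Spine C → ℕ → List ℕ → Option (Head C)
  | .nil, _, _ => none
  | .cons M _, 0, p => Tm.headAt M p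
  | .cons _ S, j + 1, p => Spine.headAt S j p
end

/-- `h` is an infinite trace of the infinitary term `M`: the sequence of the heads along an infinite
path `p` of argument positions. -/
def IsInfTrace (M : ℕ → Tm C) (h : ℕ → Head C) : Prop :=
  ∃ p : ℕ → ℕ, ∀ n, ∃ k, (M k).headAt ((List.range n).map p) = some (h n)

/-- The constructor `c` is coinductive. -/
def Sig.Coinductive (σ : Sig F C R) (c : C) : Prop :=
  ∃ A K, Decl.con c A ∈ σ ∧ Decl.fam A.target K ∈ σ ∧ K.IsCotype

/-- The constructor `c` has priority `i`, the position at which its type family is declared. -/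
def Sig.HasPriority (σ : Sig F C R) (c : C) (i : ℕ) : Prop :=
  ∃ A K, Decl.con c A ∈ σ ∧ σ[i]? = some (Decl.fam A.target K)

/-- Trace-validity: among the constructors that occur infinitely often along an infinite trace, one
of the highest priority is coinductive. -/
def Sig.TraceValid (σ : Sig F C R) (M : ℕ → Tm C) : Prop :=
  ∀ h, IsInfTrace M h →
    ∃ c, σ.Coinductive c ∧ (∃ᶠ n in Filter.atTop, h n = .con c) ∧
      ∀ c', (∃ᶠ n in Filter.atTop, h n = .con c') →
        ∃ i j, σ.HasPriority c' i ∧ σ.HasPriority c j ∧ i ≤ j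

/-- `M` is a canonical term, in the empty context, of the atomic type `a · (M₁; …; Mₙ)` indexed by
infinitary terms `Mᵢ`. -/
def Sig.Canonical (σ : Sig F C R) (a : F) (Ms : List (ℕ → Tm C)) (M : ℕ → Tm C) : Prop :=
  IsInfTm M ∧
  (∀ k, Chk σ k [] (M k) (.atom a (Spine.ofList (Ms.map fun N => N (k - 1))))) ∧
  σ.TraceValid M

end Signatures

/-! ### The signature of conatural and cobinary numbers -/

/-- Type families. -/
inductive Fam : Type
  | conat | cobin | bsucc | coplus | tobin | frombin | bplus | eqconat | eqconat_refl | bsucc_sound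

/-- Constructors. -/
inductive Con : Type
  | cozero | cosucc | b0 | b1 | bsucc_0 | bsucc_1 | coplus_0 | coplus_1 | tobin_0 | tobin_1
  | frombin_0 | frombin_1 | bplus_00 | bplus_01 | bplus_10 | bplus_11 | eqconat_0 | eqconat_1
  | eqconat_refl_0 | eqconat_refl_1 | bsucc_sound_0 | bsucc_sound_1

/-- Recursion constants. -/
inductive Rec : Type
  | bzero | bone | w1 | w2 | b0_0_is_0 | bsucc_0_is_1
  deriving DecidableEq

/-- The atomic type `a · (M₁; …; Mₙ)`. -/
abbrev at' (a : Fam) (Ms : List (FTm Con Rec)) : Ty Fam (FSpine Con Rec) :=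
  .atom a (FSpine.ofList Ms)

/-- The term `c · (M₁; …; Mₙ)`. -/
abbrev cn (c : Con) (Ms : List (FTm Con Rec)) : FTm Con Rec := .con c (FSpine.ofList Ms)

/-- The variable `i` (a de Bruijn index) without arguments. -/
abbrev v (i : ℕ) : FTm Con Rec := .var i .nil

/-- The recursion constant `r` without arguments. -/
abbrev rc (r : Rec) : FTm Con Rec := .dfn r .nil

/-- The type `Π x₁ : A₁. … Π xₙ : Aₙ. B`. -/
abbrev pis (As : List (Ty Fam (FSpine Con Rec))) (B : Ty Fam (FSpine Con Rec)) :
    Ty Fam (FSpine Con Rec) := As.foldr .pi B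

/-- The kind `Π x₁ : A₁. … Π xₙ : Aₙ. cotype`. -/
abbrev copis (As : List (Ty Fam (FSpine Con Rec))) : Kind Fam (FSpine Con Rec) :=
  As.foldr .pi .cotype

/-- The declaration `r : A = c · (M₁; …; Mₙ)`. -/
abbrev dfn (r : Rec) (A : Ty Fam (FSpine Con Rec)) (c : Con) (Ms : List (FTm Con Rec)) :
    Decl Fam Con Rec := .dfn r A 0 c (FSpine.ofList Ms)

/-- The signature, with all implicit arguments made explicit.  The comments give the names of the
variables bound by the successive `Π`s, `_` being a premise. -/
def sig : Sig Fam Con Rec :=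
  let conat := at' .conat []
  let cobin := at' .cobin []
  let bzero := rc .bzero
  let cosucc := fun X => cn .cosucc [X]
  let b0 := fun X => cn .b0 [X]
  let b1 := fun X => cn .b1 [X]
  let bsucc := fun X Y => at' .bsucc [X, Y]
  let coplus := fun X Y Z => at' .coplus [X, Y, Z]
  let tobin := fun X Y => at' .tobin [X, Y]
  let frombin := fun X Y => at' .frombin [X, Y]
  let bplus := fun X Y Z => at' .bplus [X, Y, Z]
  let eqconat := fun X Y => at' .eqconat [X, Y]
  [ .fam .conat .cotype,
    .con .cozero conat,
    .con .cosucc (pis [conat] conat),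
    .fam .cobin .cotype,
    .con .b0 (pis [cobin] cobin),
    .con .b1 (pis [cobin] cobin),
    dfn .bzero cobin .b0 [bzero],
    dfn .bone cobin .b1 [bzero],
    dfn .w1 cobin .b1 [rc .w1],
    dfn .w2 cobin .b1 [b0 (rc .w2)],
    .fam .bsucc (copis [cobin, cobin]),
    -- X
    .con .bsucc_0 (pis [cobin] (bsucc (b0 (v 0)) (b1 (v 0)))),
    -- X Y _
    .con .bsucc_1 (pis [cobin, cobin, bsucc (v 1) (v 0)] (bsucc (b1 (v 2)) (b0 (v 1)))),
    .fam .coplus (copis [conat, conat, conat]),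
    -- Y
    .con .coplus_0 (pis [conat] (coplus (cn .cozero []) (v 0) (v 0))),
    -- X Y Z _
    .con .coplus_1 (pis [conat, conat, conat, coplus (v 2) (v 1) (v 0)]
      (coplus (cosucc (v 3)) (v 2) (cosucc (v 1)))),
    .fam .tobin (copis [conat, cobin]),
    .con .tobin_0 (tobin (cn .cozero []) bzero),
    -- X Y Z _ _
    .con .tobin_1 (pis [conat, cobin, cobin, tobin (v 2) (v 1), bsucc (v 2) (v 1)]
      (tobin (cosucc (v 4)) (v 2))),
    .fam .frombin (copis [cobin, conat]),
    -- X Y Z _ _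
    .con .frombin_0 (pis [cobin, conat, conat, frombin (v 2) (v 1), coplus (v 2) (v 2) (v 1)]
      (frombin (b0 (v 4)) (v 2))),
    -- X Y Z _ _
    .con .frombin_1 (pis [cobin, conat, conat, frombin (v 2) (v 1), coplus (v 2) (v 2) (v 1)]
      (frombin (b1 (v 4)) (cosucc (v 2)))),
    .fam .bplus (copis [cobin, cobin, cobin]),
    -- X Y Z _
    .con .bplus_00 (pis [cobin, cobin, cobin, bplus (v 2) (v 1) (v 0)]
      (bplus (b0 (v 3)) (b0 (v 2)) (b0 (v 1)))),
    .con .bplus_01 (pis [cobin, cobin, cobin, bplus (v 2) (v 1) (v 0)]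
      (bplus (b0 (v 3)) (b1 (v 2)) (b1 (v 1)))),
    .con .bplus_10 (pis [cobin, cobin, cobin, bplus (v 2) (v 1) (v 0)]
      (bplus (b1 (v 3)) (b0 (v 2)) (b1 (v 1)))),
    -- X Y Z W _ _
    .con .bplus_11 (pis [cobin, cobin, cobin, cobin, bplus (v 3) (v 2) (v 1), bsucc (v 2) (v 1)]
      (bplus (b1 (v 5)) (b1 (v 4)) (b0 (v 2)))),
    dfn .b0_0_is_0 (bplus bzero bzero bzero) .bplus_00 [bzero, bzero, bzero, rc .b0_0_is_0],
    dfn .bsucc_0_is_1 (bsucc bzero (rc .bone)) .bsucc_0 [bzero],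
    .fam .eqconat (copis [conat, conat]),
    .con .eqconat_0 (eqconat (cn .cozero []) (cn .cozero [])),
    -- X Y _
    .con .eqconat_1 (pis [conat, conat, eqconat (v 1) (v 0)]
      (eqconat (cosucc (v 2)) (cosucc (v 1)))),
    -- X _
    .fam .eqconat_refl (copis [conat, eqconat (v 0) (v 0)]),
    .con .eqconat_refl_0 (at' .eqconat_refl [cn .cozero [], cn .eqconat_0 []]),
    -- X EQR _
    .con .eqconat_refl_1
      (pis [conat, eqconat (v 0) (v 0), at' .eqconat_refl [v 1, v 0]]
        (at' .eqconat_refl [cosucc (v 2), cn .eqconat_1 [v 2, v 2, v 1]])),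
    -- N M CN CM _ _ _ _
    .fam .bsucc_sound
      (copis [cobin, cobin, conat, conat, frombin (v 3) (v 1), frombin (v 3) (v 1),
        bsucc (v 5) (v 4), eqconat (cosucc (v 4)) (v 3)]),
    -- N' Y Z N'FB N'CP EQC _
    .con .bsucc_sound_0
      (pis [cobin, conat, conat, frombin (v 2) (v 1), coplus (v 2) (v 2) (v 1),
          eqconat (v 2) (v 2), at' .eqconat_refl [v 3, v 0]]
        (at' .bsucc_sound [b0 (v 6), b1 (v 6), v 4, cosucc (v 4),
          cn .frombin_0 [v 6, v 5, v 4, v 3, v 2],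
          cn .frombin_1 [v 6, v 5, v 4, v 3, v 2],
          cn .bsucc_0 [v 6],
          cn .eqconat_1 [v 4, v 4, v 1]])),
    -- N' M' CN' CM' N'FB M'FB SN'isM' EQC N'CP M'CP _
    .con .bsucc_sound_1
      (pis [cobin, cobin, conat, conat, frombin (v 3) (v 1), frombin (v 3) (v 1),
          bsucc (v 5) (v 4), eqconat (cosucc (v 4)) (v 3),
          coplus (v 5) (v 5) (v 5), coplus (v 5) (v 5) (cosucc (v 5)),
          at' .bsucc_sound [v 9, v 8, v 7, v 6, v 5, v 4, v 3, v 2]]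
        (at' .bsucc_sound [b1 (v 10), b0 (v 9), cosucc (v 8), cosucc (v 7),
          cn .frombin_1 [v 10, v 8, v 8, v 6, v 2],
          cn .frombin_0 [v 9, v 7, cosucc (v 7), v 5, v 1],
          cn .bsucc_1 [v 10, v 9, v 4],
          cn .eqconat_1 [cosucc (v 8), v 7, v 3]])) ]

/-! ### Possibly infinite derivations -/

/-- A system of inference rules for judgments `J`: rule instances with their conclusion and
premises. -/
structure Rules (J : Type) where
  Inst : Type
  concl : Inst → J
  prems : Inst → List J

/-- A possibly infinite derivation of `j`, as a tree of rule instances.  The node at the address `p`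
has its premises derived at the addresses `p ++ [0]`, `p ++ [1]`, …, and there are no other nodes. -/
@[ext]
structure Deriv {J : Type} (R : Rules J) (j : J) where
  node : List ℕ → Option R.Inst
  root : (node []).map R.concl = some j
  step : ∀ p i, node p = some i → ∀ n, (node (p ++ [n])).map R.concl = (R.prems i)[n]?
  none : ∀ p n, node p = none → node (p ++ [n]) = none

/-- The tree with root `i` and immediate subtrees `ts`. -/
def graft {I : Type} (i : I) (ts : List (List ℕ → Option I)) : List ℕ → Option I
  | [] => some i
  | n :: p => (ts[n]?).bind fun t => t p

/-- The immediate subtree number `n`. -/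
def subtree {I : Type} (t : List ℕ → Option I) (n : ℕ) : List ℕ → Option I := fun p => t (n :: p)

/-- The derivation that ends in an axiom. -/
def Deriv.node0 {J : Type} {R : Rules J} (i : R.Inst) (h : R.prems i = []) :
    Deriv R (R.concl i) where
  node := graft i []
  root := rfl
  step := by
    rintro (_ | ⟨m, p⟩) i' h' n
    · simp only [graft, Option.some.injEq] at h'
      subst h'
      simp [graft, h]
    · simp [graft] at h'
  none := by
    rintro (_ | ⟨m, p⟩) n h'
    · simp [graft] at h'
    · simp [graft]

/-- The derivation that ends in a rule with one premise. -/
def Deriv.node1 {J : Type} {R : Rules J} (i : R.Inst) {j : J} (h : R.prems i = [j])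
    (d : Deriv R j) : Deriv R (R.concl i) where
  node := graft i [d.node]
  root := rfl
  step := by
    rintro (_ | ⟨_ | m, p⟩) i' h' n
    · simp only [graft, Option.some.injEq] at h'
      subst h'
      rcases n with _ | n
      · simpa [graft, h] using d.root
      · simp [graft, h]
    · exact d.step p i' (by simpa [graft] using h') n
    · simp [graft] at h'
  none := by
    rintro (_ | ⟨_ | m, p⟩) n h'
    · simp [graft] at h'
    · simpa [graft] using d.none p n (by simpa [graft] using h')
    · simp [graft]

/-- The derivation that ends in a rule with two premises. -/
def Deriv.node2 {J : Type} {R : Rules J} (i : R.Inst) {j j' : J} (h : R.prems i = [j, j'])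
    (d : Deriv R j) (d' : Deriv R j') : Deriv R (R.concl i) where
  node := graft i [d.node, d'.node]
  root := rfl
  step := by
    rintro (_ | ⟨_ | _ | m, p⟩) i' h' n
    · simp only [graft, Option.some.injEq] at h'
      subst h'
      rcases n with _ | _ | n
      · simpa [graft, h] using d.root
      · simpa [graft, h] using d'.root
      · simp [graft, h]
    · exact d.step p i' (by simpa [graft] using h') n
    · exact d'.step p i' (by simpa [graft] using h') n
    · simp [graft] at h'
  none := by
    rintro (_ | ⟨_ | _ | m, p⟩) n h'
    · simp [graft] at h'
    · simpa [graft] using d.none p n (by simpa [graft] using h')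
    · simpa [graft] using d'.none p n (by simpa [graft] using h')
    · simp [graft]

/-! ### Cobinary numbers, conatural numbers, and the derivations about them -/

/-- Cobinary numbers: infinite sequences of bits, the least significant bit first. -/
abbrev Cobin : Type := Stream' Bool

/-- The cobinary number with a digit `0` in front. -/
abbrev Cobin.b0 (N : Cobin) : Cobin := Stream'.cons false N

/-- The cobinary number with a digit `1` in front. -/
abbrev Cobin.b1 (N : Cobin) : Cobin := Stream'.cons true N

/-- The successor of a cobinary number (binary increment, least significant bit first): a bit is
flipped iff all the bits before it are `1`. -/
def Cobin.succ (N : Cobin) : Cobin :=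
  fun i => xor (N.get i) (decide (∀ j < i, N.get j = true))

/-- Judgments about cobinary and conatural numbers; the conatural numbers are `ℕ∞`. -/
inductive Judg : Type
  | bsucc (N M : Cobin)
  | coplus (X Y Z : ℕ∞)
  | frombin (N : Cobin) (X : ℕ∞)
  | eqconat (X Y : ℕ∞)

/-- Instances of the rules for these judgments. -/
inductive RuleInst : Type
  | bsucc_0 (X : Cobin)
  | bsucc_1 (X Y : Cobin)
  | coplus_0 (Y : ℕ∞)
  | coplus_1 (X Y Z : ℕ∞)
  | frombin_0 (X : Cobin) (Y Z : ℕ∞)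
  | frombin_1 (X : Cobin) (Y Z : ℕ∞)
  | eqconat_0
  | eqconat_1 (X Y : ℕ∞)

/-- The conclusion of a rule instance. -/
def RuleInst.concl : RuleInst → Judg
  | .bsucc_0 X => .bsucc X.b0 X.b1
  | .bsucc_1 X Y => .bsucc X.b1 Y.b0
  | .coplus_0 Y => .coplus 0 Y Y
  | .coplus_1 X Y Z => .coplus (X + 1) Y (Z + 1)
  | .frombin_0 X _ Z => .frombin X.b0 Z
  | .frombin_1 X _ Z => .frombin X.b1 (Z + 1)
  | .eqconat_0 => .eqconat 0 0
  | .eqconat_1 X Y => .eqconat (X + 1) (Y + 1)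

/-- The premises of a rule instance. -/
def RuleInst.prems : RuleInst → List Judg
  | .bsucc_0 _ => []
  | .bsucc_1 X Y => [.bsucc X Y]
  | .coplus_0 _ => []
  | .coplus_1 X Y Z => [.coplus X Y Z]
  | .frombin_0 X Y Z => [.frombin X Y, .coplus Y Y Z]
  | .frombin_1 X Y Z => [.frombin X Y, .coplus Y Y Z]
  | .eqconat_0 => []
  | .eqconat_1 X Y => [.eqconat X Y]

/-- The rules for `bsucc`, `coplus`, `frombin` and `eqconat`. -/
def rules : Rules Judg := ⟨RuleInst, RuleInst.concl, RuleInst.prems⟩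

/-- Derivations of judgments about cobinary and conatural numbers. -/
abbrev Der (j : Judg) : Type := Deriv rules j

/-- The rule `bsucc/0`. -/
def Der.bsucc_0 (X : Cobin) : Der (.bsucc X.b0 X.b1) :=
  Deriv.node0 (R := rules) (RuleInst.bsucc_0 X) rfl

/-- The rule `bsucc/1`. -/
def Der.bsucc_1 {X Y : Cobin} (d : Der (.bsucc X Y)) : Der (.bsucc X.b1 Y.b0) :=
  Deriv.node1 (R := rules) (RuleInst.bsucc_1 X Y) rfl d

/-- The rule `frombin/0`. -/
def Der.frombin_0 {X : Cobin} {Y Z : ℕ∞} (d : Der (.frombin X Y)) (d' : Der (.coplus Y Y Z)) :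
    Der (.frombin X.b0 Z) :=
  Deriv.node2 (R := rules) (RuleInst.frombin_0 X Y Z) rfl d d'

/-- The rule `frombin/1`. -/
def Der.frombin_1 {X : Cobin} {Y Z : ℕ∞} (d : Der (.frombin X Y)) (d' : Der (.coplus Y Y Z)) :
    Der (.frombin X.b1 (Z + 1)) :=
  Deriv.node2 (R := rules) (RuleInst.frombin_1 X Y Z) rfl d d'

/-- The rule `eqconat/0`. -/
def Der.eqconat_0 : Der (.eqconat 0 0) :=
  Deriv.node0 (R := rules) RuleInst.eqconat_0 rfl

/-- The rule `eqconat/1`. -/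
def Der.eqconat_1 {X Y : ℕ∞} (d : Der (.eqconat X Y)) : Der (.eqconat (X + 1) (Y + 1)) :=
  Deriv.node1 (R := rules) (RuleInst.eqconat_1 X Y) rfl d

/-- Judgments about derivations: `E` is a derivation by reflexivity, and the successor `M` of `N`
(evidenced by `S`) has as its unary value the successor of the unary value of `N` (evidenced by `E`),
the unary values of `N` and `M` being `CN` and `CM` (evidenced by `FN` and `FM`). -/
inductive SJudg : Type
  | refl (X : ℕ∞) (E : Der (.eqconat X X))
  | sound (N M : Cobin) (CN CM : ℕ∞) (FN : Der (.frombin N CN)) (FM : Der (.frombin M CM))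
      (S : Der (.bsucc N M)) (E : Der (.eqconat (CN + 1) CM))

/-- Instances of the rules for these judgments. -/
inductive SRuleInst : Type
  | refl_0
  | refl_1 (X : ℕ∞) (E : Der (.eqconat X X))
  | sound_0 (N : Cobin) (Y Z : ℕ∞) (FN : Der (.frombin N Y)) (P : Der (.coplus Y Y Z))
      (E : Der (.eqconat Z Z))
  | sound_1 (N M : Cobin) (CN CM : ℕ∞) (FN : Der (.frombin N CN)) (FM : Der (.frombin M CM))
      (S : Der (.bsucc N M)) (E : Der (.eqconat (CN + 1) CM))
      (PN : Der (.coplus CN CN CN)) (PM : Der (.coplus CM CM (CM + 1)))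

/-- The conclusion of a rule instance. -/
def SRuleInst.concl : SRuleInst → SJudg
  | .refl_0 => .refl 0 Der.eqconat_0
  | .refl_1 X E => .refl (X + 1) E.eqconat_1
  | .sound_0 N _ Z FN P E =>
      .sound N.b0 N.b1 Z (Z + 1) (FN.frombin_0 P) (FN.frombin_1 P) (Der.bsucc_0 N) E.eqconat_1
  | .sound_1 N M CN CM FN FM S E PN PM =>
      .sound N.b1 M.b0 (CN + 1) (CM + 1) (FN.frombin_1 PN) (FM.frombin_0 PM) S.bsucc_1 E.eqconat_1

/-- The premises of a rule instance. -/
def SRuleInst.prems : SRuleInst → List SJudg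
  | .refl_0 => []
  | .refl_1 X E => [.refl X E]
  | .sound_0 _ _ Z _ _ E => [.refl Z E]
  | .sound_1 N M CN CM FN FM S E _ _ => [.sound N M CN CM FN FM S E]

/-- The rules for `eqconat/refl` and `bsucc_sound`. -/
def srules : Rules SJudg := ⟨SRuleInst, SRuleInst.concl, SRuleInst.prems⟩

/-- Derivations of the soundness of the cobinary successor. -/
abbrev SDer (j : SJudg) : Type := Deriv srules j

/-! ### The encodings, given by their observations at depth `k` -/

/-- The term `c · (M₁; …; Mₙ)`. -/
abbrev node (c : Con) (Ms : List (Tm Con)) : Tm Con := .con c (Spine.ofList Ms)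

/-- The encoding of a cobinary number. -/
def encCobin (N : Cobin) : ℕ → Tm Con
  | 0 => .unobs
  | k + 1 => node (if N.head then .b1 else .b0) [encCobin N.tail k]

/-- The encoding of a conatural number. -/
def encConat (X : ℕ∞) : ℕ → Tm Con
  | 0 => .unobs
  | k + 1 => if X = 0 then node .cozero [] else node .cosucc [encConat (X - 1) k]

/-- The encoding of a tree of rule instances. -/
def encTree (t : List ℕ → Option RuleInst) : ℕ → Tm Con
  | 0 => .unobs
  | k + 1 =>
    match t [] with
    | none => .unobs
    | some (.bsucc_0 X) => node .bsucc_0 [encCobin X k]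
    | some (.bsucc_1 X Y) => node .bsucc_1 [encCobin X k, encCobin Y k, encTree (subtree t 0) k]
    | some (.coplus_0 Y) => node .coplus_0 [encConat Y k]
    | some (.coplus_1 X Y Z) =>
        node .coplus_1 [encConat X k, encConat Y k, encConat Z k, encTree (subtree t 0) k]
    | some (.frombin_0 X Y Z) =>
        node .frombin_0 [encCobin X k, encConat Y k, encConat Z k, encTree (subtree t 0) k,
          encTree (subtree t 1) k]
    | some (.frombin_1 X Y Z) =>
        node .frombin_1 [encCobin X k, encConat Y k, encConat Z k, encTree (subtree t 0) k,
          encTree (subtree t 1) k]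
    | some .eqconat_0 => node .eqconat_0 []
    | some (.eqconat_1 X Y) =>
        node .eqconat_1 [encConat X k, encConat Y k, encTree (subtree t 0) k]

/-- The encoding of a derivation. -/
def Der.enc {j : Judg} (d : Der j) : ℕ → Tm Con := encTree d.node

/-- The encoding of a tree of rule instances. -/
def encSTree (t : List ℕ → Option SRuleInst) : ℕ → Tm Con
  | 0 => .unobs
  | k + 1 =>
    match t [] with
    | none => .unobs
    | some .refl_0 => node .eqconat_refl_0 []
    | some (.refl_1 X E) =>
        node .eqconat_refl_1 [encConat X k, E.enc k, encSTree (subtree t 0) k]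
    | some (.sound_0 N Y Z FN P E) =>
        node .bsucc_sound_0 [encCobin N k, encConat Y k, encConat Z k, FN.enc k, P.enc k, E.enc k,
          encSTree (subtree t 0) k]
    | some (.sound_1 N M CN CM FN FM S E PN PM) =>
        node .bsucc_sound_1 [encCobin N k, encCobin M k, encConat CN k, encConat CM k, FN.enc k,
          FM.enc k, S.enc k, E.enc k, PN.enc k, PM.enc k, encSTree (subtree t 0) k]

/-- The encoding of a derivation. -/
def SDer.enc {j : SJudg} (d : SDer j) : ℕ → Tm Con := encSTree d.node

end CoLF

namespace CoLF

/-! ### Ground terms: closed terms built from constants only -/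

section Ground
variable {C : Type}

-- The proof trades depth-indexed checking with hereditary substitution for pattern matching on
-- infinite first-order trees. All argument types of constructors are atomic, so a closed term of
-- atomic type contains neither variables nor abstractions (`Chk.ground`). Shifting and substitution
-- leave such ground terms alone, and substituting one into a type merely extends an assignment of
-- its variables (`Ty.hsub_inst`). Hence a constructor applied to ground arguments checks at depth
-- `k + 1` iff the arguments match its declared type at depth `k` (`typedAt_mk`). When this holds at
-- every depth, the equations between indices become equations between infinite terms
-- (`matches_of_forall`). Trace-validity costs nothing: all families are coinductive and there are
-- finitely many constructors (`IsGround.traceValid`). Canonicity is therefore groundness plus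
-- typing at all depths (`canonical_iff`).
--
-- Encodings are well-typed by induction on the depth. They are injective because every parameter of
-- a rule instance is an explicit argument of the term, so a tree can be recovered node by node
-- (`RuleInst.enc_inj`, `SRuleInst.enc_inj`). Surjectivity combines inversion at the root with
-- corecursion (`Can.exists_encCobin`, `Can.exists_sDer`).
--
-- The decisive point for `bsucc_sound` is that each argument of its constructors, apart from the
-- recursive premise, occurs in the indices of the result type. Those indices are encodings of given
-- data, so inverting them shows that the arguments are themselves encodings and form a rule
-- instance (`Can.exists_sound`). No classification of the canonical terms of `frombin`, `coplus` or
-- `eqconat` is needed.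
--
-- For `bsucc`, inversion determines the second index bit by bit (`Can.eq_succ`), and `succTm`
-- inhabits the type of the true successor.

mutual
/-- `M` has depth `k` and all its heads are constants. -/
def Tm.Ground : ℕ → Tm C → Prop
  | 0, .unobs => True
  | 0, .lam _ => False
  | 0, .var _ _ => False
  | 0, .con _ _ => False
  | _ + 1, .unobs => False
  | _ + 1, .lam _ => False
  | _ + 1, .var _ _ => False
  | k + 1, .con _ S => Spine.Ground k S
/-- Every argument of the spine is ground of depth `k`. -/
def Spine.Ground : ℕ → Spine C → Prop
  | _, .nil => True
  | k, .cons M S => Tm.Ground k M ∧ Spine.Ground k S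
end

mutual
theorem Tm.Ground.hasDepth : ∀ {k : ℕ} {M : Tm C}, M.Ground k → M.HasDepth k
  | 0, .unobs, _ => by simp [Tm.HasDepth]
  | _ + 1, .con _ _, h => by
      simp only [Tm.Ground, Tm.HasDepth] at h ⊢
      exact Spine.Ground.hasDepth h
theorem Spine.Ground.hasDepth : ∀ {k : ℕ} {S : Spine C}, S.Ground k → S.HasDepth k
  | _, .nil, _ => by simp [Spine.HasDepth]
  | _, .cons _ _, h => by
      simp only [Spine.Ground, Spine.HasDepth] at h ⊢
      exact ⟨h.1.hasDepth, Spine.Ground.hasDepth h.2⟩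
end

mutual
theorem Tm.Ground.shift_eq {n : ℕ} :
    ∀ {k : ℕ} {M : Tm C} (d : ℕ), M.Ground k → M.shift n d = M
  | 0, .unobs, _, _ => by simp [Tm.shift]
  | _ + 1, .con _ _, d, h => by
      simp only [Tm.Ground, Tm.shift] at h ⊢
      rw [Spine.Ground.shift_eq d h]
theorem Spine.Ground.shift_eq {n : ℕ} :
    ∀ {k : ℕ} {S : Spine C} (d : ℕ), S.Ground k → S.shift n d = S
  | _, .nil, _, _ => by simp [Spine.shift]
  | _, .cons _ _, d, h => by
      simp only [Spine.Ground, Spine.shift] at h ⊢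
      rw [h.1.shift_eq d, Spine.Ground.shift_eq d h.2]
end

mutual
theorem Tm.Ground.trunc_self : ∀ {k : ℕ} {M : Tm C}, M.Ground k → M.trunc k = M
  | 0, .unobs, _ => by simp [Tm.trunc]
  | _ + 1, .con _ _, h => by
      simp only [Tm.Ground, Tm.trunc] at h ⊢
      rw [Spine.Ground.trunc_self h]
theorem Spine.Ground.trunc_self : ∀ {k : ℕ} {S : Spine C}, S.Ground k → S.trunc k = S
  | _, .nil, _ => by simp [Spine.trunc]
  | _, .cons _ _, h => by
      simp only [Spine.Ground, Spine.trunc] at h ⊢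
      rw [h.1.trunc_self, Spine.Ground.trunc_self h.2]
end

mutual
theorem Tm.Ground.hsubWith_eq {app : ℕ → Spine C → Tm C → Option (Tm C)} {x : ℕ} :
    ∀ {k : ℕ} {M : Tm C} (N : Tm C), M.Ground k → Tm.hsubWith app k N x M = some M
  | 0, .unobs, _, _ => by simp [Tm.hsubWith]
  | k + 1, .con _ _, N, h => by
      simp only [Tm.Ground, Tm.hsubWith] at h ⊢
      rw [Spine.Ground.hsubWith_eq (N.trunc k) h]
      rfl
theorem Spine.Ground.hsubWith_eq {app : ℕ → Spine C → Tm C → Option (Tm C)} {x : ℕ} :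
    ∀ {k : ℕ} {S : Spine C} (N : Tm C), S.Ground k → Spine.hsubWith app k N x S = some S
  | _, .nil, _, _ => by simp [Spine.hsubWith]
  | _, .cons _ _, N, h => by
      simp only [Spine.Ground, Spine.hsubWith] at h ⊢
      rw [h.1.hsubWith_eq N, Spine.Ground.hsubWith_eq N h.2]
      rfl
end

mutual
theorem Tm.Ground.headAt_eq : ∀ {k : ℕ} {M : Tm C} {p : List ℕ} {h : Head C},
    M.Ground k → M.headAt p = some h → ∃ c, h = .con c
  | 0, .unobs, _, _, _, e => by simp [Tm.headAt] at e
  | _ + 1, .con c _, [], _, _, e => by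
      simp only [Tm.headAt, Option.some.injEq] at e
      exact ⟨c, e.symm⟩
  | _ + 1, .con _ _, j :: p, _, g, e => by
      simp only [Tm.Ground, Tm.headAt] at g e
      exact Spine.Ground.headAt_eq g e
theorem Spine.Ground.headAt_eq : ∀ {k : ℕ} {S : Spine C} {j : ℕ} {p : List ℕ} {h : Head C},
    S.Ground k → S.headAt j p = some h → ∃ c, h = .con c
  | _, .nil, _, _, _, _, e => by simp [Spine.headAt] at e
  | _, .cons _ _, 0, _, _, g, e => by
      simp only [Spine.Ground, Spine.headAt] at g e
      exact g.1.headAt_eq e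
  | _, .cons _ _, _ + 1, _, _, g, e => by
      simp only [Spine.Ground, Spine.headAt] at g e
      exact Spine.Ground.headAt_eq g.2 e
end

mutual
theorem Tm.trunc_trunc_self : ∀ (k : ℕ) (M : Tm C), (M.trunc k).trunc k = M.trunc k
  | 0, _ => by simp [Tm.trunc]
  | _ + 1, .unobs => by simp [Tm.trunc]
  | k + 1, .lam M => by simp [Tm.trunc, Tm.trunc_trunc_self (k + 1) M]
  | k + 1, .var _ S => by simp [Tm.trunc, Spine.trunc_trunc_self (k + 1) S]
  | k + 1, .con _ S => by simp [Tm.trunc, Spine.trunc_trunc_self k S]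
theorem Spine.trunc_trunc_self : ∀ (k : ℕ) (S : Spine C), (S.trunc k).trunc k = S.trunc k
  | _, .nil => by simp [Spine.trunc]
  | k, .cons M S => by
      simp [Spine.trunc, Tm.trunc_trunc_self k M, Spine.trunc_trunc_self k S]
end

-- Argument lists and coherent families of ground terms

theorem Spine.ofList_injective : Function.Injective (Spine.ofList (C := C))
  | [], [], _ => rfl
  | [], _ :: _, h => by simp [Spine.ofList] at h
  | _ :: _, [], h => by simp [Spine.ofList] at h
  | _ :: _, _ :: _, h => by
      simp only [Spine.ofList, Spine.cons.injEq] at h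
      rw [h.1, Spine.ofList_injective h.2]

theorem Spine.ground_ofList {k : ℕ} :
    ∀ {Ms : List (Tm C)}, (Spine.ofList Ms).Ground k ↔ ∀ M ∈ Ms, M.Ground k
  | [] => by simp [Spine.ofList, Spine.Ground]
  | M :: Ms => by simp [Spine.ofList, Spine.Ground, Spine.ground_ofList (Ms := Ms)]

theorem Spine.trunc_ofList {k : ℕ} :
    ∀ {Ms : List (Tm C)}, (Spine.ofList Ms).trunc k = Spine.ofList (Ms.map (Tm.trunc k))
  | [] => by simp [Spine.ofList, Spine.trunc]
  | M :: Ms => by simp [Spine.ofList, Spine.trunc, Spine.trunc_ofList (Ms := Ms)]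

theorem Spine.exists_ofList : ∀ S : Spine C, ∃ Ms, S = Spine.ofList Ms
  | .nil => ⟨[], rfl⟩
  | .cons M S => by
      obtain ⟨Ms, rfl⟩ := Spine.exists_ofList S
      exact ⟨M :: Ms, rfl⟩

/-- A coherent family of ground terms. -/
def IsGround (D : ℕ → Tm C) : Prop := ∀ k, (D k).Ground k ∧ (D (k + 1)).trunc k = D k

theorem IsGround.isInfTm {D : ℕ → Tm C} (h : IsGround D) : IsInfTm D :=
  fun k => ⟨(h k).1.hasDepth, (h k).2⟩

theorem IsGround.zero {D : ℕ → Tm C} (h : IsGround D) : D 0 = .unobs := by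
  rw [← (h 0).2]; simp [Tm.trunc]

/-- The infinitary term `c · (M₁; …; Mₙ)`. -/
def mk (c : C) (Ms : List (ℕ → Tm C)) : ℕ → Tm C
  | 0 => .unobs
  | k + 1 => .con c (Spine.ofList (Ms.map (· k)))

theorem ext_of_map_eval {α : Type} : ∀ {Ms Ns : List (ℕ → α)},
    (∀ k, Ms.map (· k) = Ns.map (· k)) → Ms = Ns
  | [], [], _ => rfl
  | [], _ :: _, h => by simpa using h 0
  | _ :: _, [], h => by simpa using h 0
  | M :: Ms, N :: Ns, h => by
      simp only [List.map_cons, List.cons.injEq] at h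
      rw [funext fun k => (h k).1, ext_of_map_eval fun k => (h k).2]

@[simp]
theorem mk_inj {c c' : C} {Ms Ns : List (ℕ → Tm C)} :
    mk c Ms = mk c' Ns ↔ c = c' ∧ Ms = Ns := by
  constructor
  · intro h
    have h' : ∀ k, c = c' ∧ Ms.map (· k) = Ns.map (· k) := by
      intro k
      have := congrFun h (k + 1)
      simp only [mk, Tm.con.injEq] at this
      exact ⟨this.1, Spine.ofList_injective this.2⟩
    exact ⟨(h' 0).1, ext_of_map_eval fun k => (h' k).2⟩
  · rintro ⟨rfl, rfl⟩; rfl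

/-- Truncation preserves length, so all the lists have the same length and a sequence of lists can
be transposed into a list of sequences. -/
theorem exists_families {L : ℕ → List (Tm C)}
    (hg : ∀ k, ∀ M ∈ L k, M.Ground k) (hc : ∀ k, (L (k + 1)).map (Tm.trunc k) = L k) :
    ∃ Ms : List (ℕ → Tm C), (∀ M ∈ Ms, IsGround M) ∧ ∀ k, L k = Ms.map (· k) := by
  obtain ⟨n, hn⟩ : ∃ n, (L 0).length = n := ⟨_, rfl⟩
  induction n generalizing L with
  | zero =>
    have : ∀ k, L k = [] := by
      intro k
      induction k with
      | zero => exact List.length_eq_zero_iff.1 hn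
      | succ k ih => have := hc k; rw [ih] at this; simpa using this
    exact ⟨[], by simp, by simp [this]⟩
  | succ n ih =>
    have hlen : ∀ k, (L k).length = n + 1 := by
      intro k
      induction k with
      | zero => exact hn
      | succ k ih => rw [← ih, ← hc k]; simp
    have hne : ∀ k, ∃ M Ms, L k = M :: Ms := fun k =>
      List.exists_cons_of_length_eq_add_one (hlen k)
    choose f g hfg using hne
    simp only [hfg, List.mem_cons, forall_eq_or_imp, List.map_cons, List.cons.injEq] at hg hc
    obtain ⟨Ms, h1, h2⟩ := ih (L := g) (fun k => (hg k).2) (fun k => (hc k).2)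
      (by have := hlen 0; simpa [hfg] using this)
    refine ⟨f :: Ms, ?_, fun k => by simp [hfg, h2]⟩
    intro M hM
    rcases List.mem_cons.1 hM with rfl | hM
    · exact fun k => ⟨(hg k).1, (hc k).1⟩
    · exact h1 M hM

/-- Coherence forces the same head constant at every positive depth, and the observed argument lists
are again coherent. This is the case analysis on infinite terms used throughout. -/
theorem IsGround.exists_mk {D : ℕ → Tm C} (h : IsGround D) :
    ∃ c Ms, (∀ M ∈ Ms, IsGround M) ∧ D = CoLF.mk c Ms := by
  have hcon : ∀ k, ∃ c L, D (k + 1) = .con c (Spine.ofList L) := by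
    intro k
    have := (h (k + 1)).1
    cases hD : D (k + 1) with
    | con c S => obtain ⟨L, rfl⟩ := S.exists_ofList; exact ⟨c, L, rfl⟩
    | unobs => simp [hD, Tm.Ground] at this
    | lam M => simp [hD, Tm.Ground] at this
    | var i S => simp [hD, Tm.Ground] at this
  choose c L hL using hcon
  have hc : ∀ k, c (k + 1) = c k ∧ (L (k + 1)).map (Tm.trunc k) = L k := by
    intro k
    have := (h (k + 1)).2
    simp only [hL, Tm.trunc, Spine.trunc_ofList, Tm.con.injEq] at this
    exact ⟨this.1, Spine.ofList_injective this.2⟩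
  obtain ⟨Ms, h1, h2⟩ := exists_families (L := L)
    (fun k => by
      have := (h (k + 1)).1
      simpa only [hL, Tm.Ground, Spine.ground_ofList] using this)
    (fun k => (hc k).2)
  have hc0 : ∀ k, c k = c 0 := by
    intro k
    induction k with
    | zero => rfl
    | succ k ih => rw [(hc k).1, ih]
  refine ⟨c 0, Ms, h1, funext fun k => ?_⟩
  cases k with
  | zero => exact h.zero
  | succ k => rw [hL, hc0, h2]; rfl

end Ground

/-! ### First-order finitary terms and their instances -/

section Inst
variable {F C R : Type}

mutual
/-- Terms without abstractions, applied variables and recursion constants. -/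
def FTm.FO : FTm C R → Prop
  | .var _ S => S = .nil
  | .con _ S => FSpine.FO S
  | .lam _ => False
  | .dfn _ _ => False
/-- All arguments are first-order. -/
def FSpine.FO : FSpine C R → Prop
  | .nil => True
  | .cons M S => FTm.FO M ∧ FSpine.FO S
end

mutual
/-- The instance of a first-order term under an assignment of infinitary terms to variables. -/
def FTm.inst (e : ℕ → ℕ → Tm C) : FTm C R → ℕ → Tm C
  | .var i _ => e i
  | .con c S => mk c (FSpine.inst e S)
  -- Junk values: abstractions and recursion constants are excluded by `FTm.FO`.
  | .lam _ => fun _ => .unobs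
  | .dfn _ _ => fun _ => .unobs
/-- The instances of the arguments of a spine. -/
def FSpine.inst (e : ℕ → ℕ → Tm C) : FSpine C R → List (ℕ → Tm C)
  | .nil => []
  | .cons M S => FTm.inst e M :: FSpine.inst e S
end

mutual
theorem FTm.trunc_inst {e : ℕ → ℕ → Tm C} (he : ∀ i k, (e i (k + 1)).trunc k = e i k) :
    ∀ {M : FTm C R} (k : ℕ), (M.inst e (k + 1)).trunc k = M.inst e k
  | .var i _, k => by simpa [FTm.inst] using he i k
  | .con _ _, 0 => by simp [FTm.inst, mk, Tm.trunc]
  | .con _ S, k + 1 => by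
      simp only [FTm.inst, mk, Tm.trunc, Spine.trunc_ofList, List.map_map]
      rw [← FSpine.trunc_inst he k]
      simp
  | .lam _, 0 => by simp [FTm.inst, Tm.trunc]
  | .lam _, k + 1 => by simp [FTm.inst, Tm.trunc]
  | .dfn _ _, 0 => by simp [FTm.inst, Tm.trunc]
  | .dfn _ _, k + 1 => by simp [FTm.inst, Tm.trunc]
theorem FSpine.trunc_inst {e : ℕ → ℕ → Tm C} (he : ∀ i k, (e i (k + 1)).trunc k = e i k) :
    ∀ {S : FSpine C R} (k : ℕ),
      ((S.inst e).map (· (k + 1))).map (Tm.trunc k) = (S.inst e).map (· k)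
  | .nil, _ => by simp [FSpine.inst]
  | .cons _ S, k => by
      simp only [FSpine.inst, List.map_cons, FTm.trunc_inst he k, FSpine.trunc_inst he k]
end

mutual
theorem FTm.hsubWith_inst {app : ℕ → Spine C → Tm C → Option (Tm C)} {x : ℕ} {N : ℕ → Tm C}
    (hN : ∀ k, (N (k + 1)).trunc k = N k) {e e' : ℕ → ℕ → Tm C}
    (he : ∀ i k, Tm.hsubWith app k (N k) x (e i k) = some (e' i k)) :
    ∀ {M : FTm C R} (k : ℕ), M.FO →
      Tm.hsubWith app k (N k) x (M.inst e k) = some (M.inst e' k)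
  | .var i _, k, _ => by simpa [FTm.inst] using he i k
  | .con _ _, 0, _ => by simp [FTm.inst, mk, Tm.hsubWith]
  | .con _ S, k + 1, h => by
      simp only [FTm.FO, FTm.inst, mk, Tm.hsubWith] at h ⊢
      rw [hN, FSpine.hsubWith_inst hN he k h]
      rfl
theorem FSpine.hsubWith_inst {app : ℕ → Spine C → Tm C → Option (Tm C)} {x : ℕ}
    {N : ℕ → Tm C} (hN : ∀ k, (N (k + 1)).trunc k = N k) {e e' : ℕ → ℕ → Tm C}
    (he : ∀ i k, Tm.hsubWith app k (N k) x (e i k) = some (e' i k)) :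
    ∀ {S : FSpine C R} (k : ℕ), S.FO →
      Spine.hsubWith app k (N k) x (Spine.ofList ((S.inst e).map (· k))) =
        some (Spine.ofList ((S.inst e').map (· k)))
  | .nil, _, _ => by simp [FSpine.inst, Spine.ofList, Spine.hsubWith]
  | .cons _ S, k, h => by
      simp only [FSpine.FO] at h
      simp only [FSpine.inst, List.map_cons, Spine.ofList, Spine.hsubWith]
      rw [FTm.hsubWith_inst hN he k h.1, FSpine.hsubWith_inst hN he k h.2]
      rfl
end

/-- A variable as an infinitary term. -/
def varTm (i : ℕ) : ℕ → Tm C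
  | 0 => .unobs
  | _ + 1 => .var i .nil

/-- The assignment that keeps the first `d` variables and sends the following ones to `ρ`. -/
def env (d : ℕ) (ρ : List (ℕ → Tm C)) (i : ℕ) : ℕ → Tm C :=
  -- Indices beyond `ρ` stay variables, lowered by the number of variables already instantiated.
  if i < d then varTm i else ρ.getD (i - d) (varTm (i - ρ.length))

theorem env_nil (d : ℕ) : env (C := C) d [] = varTm := by
  funext i; simp [env]

theorem hsubWith_varTm_of_lt {τ : STy} {x y : ℕ} (h : y < x) (N : Tm C) (k : ℕ) :
    Tm.hsubWith (appSpine τ) k N x (varTm y k) = some (varTm y k) := by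
  cases k with
  | zero => simp [varTm, Tm.hsubWith]
  | succ k => simp [varTm, Tm.hsubWith, Spine.hsubWith, h.ne, h.not_gt]

theorem hsubWith_varTm_of_gt {τ : STy} {x y : ℕ} (h : x < y) (N : Tm C) (k : ℕ) :
    Tm.hsubWith (appSpine τ) k N x (varTm y k) = some (varTm (y - 1) k) := by
  cases k with
  | zero => simp [varTm, Tm.hsubWith]
  | succ k => simp [varTm, Tm.hsubWith, Spine.hsubWith, h.ne', h]

/-- Applying the empty spine at the base type is defined only on neutral terms. A ground term has a
constant head at every positive depth, so it is returned unchanged. -/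
theorem hsubWith_varTm_self {x : ℕ} {N : ℕ → Tm C} (hN : IsGround N) (k : ℕ) :
    Tm.hsubWith (appSpine .base) k (N k) x (varTm x k) = some (N k) := by
  obtain ⟨c, Ms, -, rfl⟩ := hN.exists_mk
  cases k with
  | zero => simp [Tm.hsubWith, mk]
  | succ k => simp [varTm, Tm.hsubWith, Spine.hsubWith, mk, appSpine]

/-- Substitution for the variable `d` pushes `N` onto the assignment: smaller indices stay put,
ground entries of `ρ` are unaffected, and the remaining free variables drop by one. -/
theorem hsubWith_env {d : ℕ} {ρ : List (ℕ → Tm C)} (hρ : ∀ M ∈ ρ, IsGround M)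
    {N : ℕ → Tm C} (hN : IsGround N) (i k : ℕ) :
    Tm.hsubWith (appSpine .base) k (N k) d (env (d + 1) ρ i k) = some (env d (N :: ρ) i k) := by
  rcases lt_trichotomy i d with h | rfl | h
  · simp only [env, h, h.trans (Nat.lt_succ_self d), if_true]
    exact hsubWith_varTm_of_lt h _ k
  · simpa [env] using hsubWith_varTm_self hN k
  · obtain ⟨j, rfl⟩ : ∃ j, i = d + 1 + j := ⟨i - (d + 1), by omega⟩
    have e1 : d + 1 + j - d = j + 1 := by omega
    simp only [env, show ¬ d + 1 + j < d + 1 by omega, show ¬ d + 1 + j < d by omega, if_false, e1,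
      Nat.add_sub_cancel_left, List.getD_cons_succ]
    by_cases hj : j < ρ.length
    · rw [List.getD_eq_getElem _ _ hj, List.getD_eq_getElem _ _ hj]
      exact (hρ _ (List.getElem_mem hj) k).1.hsubWith_eq _
    · rw [List.getD_eq_default _ _ (by omega), List.getD_eq_default _ _ (by omega),
        hsubWith_varTm_of_gt (by omega)]
      simp only [List.length_cons]
      congr 2

theorem trunc_env {d : ℕ} {ρ : List (ℕ → Tm C)} (hρ : ∀ M ∈ ρ, IsGround M) (i k : ℕ) :
    (env d ρ i (k + 1)).trunc k = env d ρ i k := by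
  have hv : ∀ i, (varTm (C := C) i (k + 1)).trunc k = varTm i k := by
    intro i
    cases k <;> simp [varTm, Tm.trunc, Spine.trunc]
  unfold env
  split_ifs with h
  · exact hv i
  · by_cases hj : i - d < ρ.length
    · rw [List.getD_eq_getElem _ _ hj]
      exact (hρ _ (List.getElem_mem hj) k).2
    · rw [List.getD_eq_default _ _ (by omega)]
      exact hv _

/-- Types `Π x₁ : a₁ · S₁. … Π xₙ : aₙ · Sₙ. a · S` in which all terms are first-order. -/
def Ty.FO : Ty F (FSpine C R) → Prop
  | .atom _ S => S.FO
  | .pi (.atom _ S) B => S.FO ∧ B.FO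
  | .pi (.pi _ _) _ => False

/-- The instance at depth `k` of the terms in a type. -/
def Ty.inst (ρ : List (ℕ → Tm C)) (k : ℕ) : ℕ → Ty F (FSpine C R) → Ty F (Spine C)
  | d, .atom a S => .atom a (Spine.ofList ((S.inst (env d ρ)).map (· k)))
  | d, .pi A B => .pi (A.inst ρ k d) (B.inst ρ k (d + 1))

variable [DecidableEq R]

mutual
theorem FTm.exp_eq_inst (σ : Sig F C R) :
    ∀ {M : FTm C R} (k : ℕ), M.FO → M.exp σ k = some (M.inst varTm k)
  | .var i _, 0, _ => by simp [FTm.inst, FTm.exp, varTm]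
  | .var i _, k + 1, h => by
      simp only [FTm.FO] at h
      subst h
      simp [FTm.inst, FTm.exp, varTm, FTm.expWith, FSpine.expWith]
  | .con _ _, 0, _ => by simp [FTm.inst, mk, FTm.exp]
  | .con _ S, k + 1, h => by
      simp only [FTm.FO, FTm.inst, mk, FTm.exp, FTm.expWith] at h ⊢
      rw [FSpine.mapArgs_exp_eq_inst σ k h]
      rfl
theorem FSpine.mapArgs_exp_eq_inst (σ : Sig F C R) :
    ∀ {S : FSpine C R} (k : ℕ), S.FO →
      FSpine.mapArgs (FTm.exp σ k) S = some (Spine.ofList ((S.inst varTm).map (· k)))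
  | .nil, _, _ => by simp [FSpine.inst, Spine.ofList, FSpine.mapArgs]
  | .cons _ S, k, h => by
      simp only [FSpine.FO] at h
      simp only [FSpine.inst, List.map_cons, Spine.ofList, FSpine.mapArgs]
      rw [FTm.exp_eq_inst σ k h.1, FSpine.mapArgs_exp_eq_inst σ k h.2]
      rfl
end

/-- Terms inside a type of depth `k + 1` have depth `k`. The number `d` is arbitrary because the
empty assignment fixes every variable. -/
theorem Ty.exp_eq_inst (σ : Sig F C R) (k : ℕ) :
    ∀ {A : Ty F (FSpine C R)} (d : ℕ), A.FO → A.exp σ (k + 1) = some (A.inst [] k d)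
  | .atom a S, d, h => by
      simp only [Ty.FO] at h
      simp [Ty.exp, Ty.inst, env_nil, FSpine.mapArgs_exp_eq_inst σ k h]
  | .pi (.atom a S) B, d, h => by
      simp only [Ty.FO] at h
      simp only [Ty.exp, Ty.inst, env_nil, Nat.add_sub_cancel,
        FSpine.mapArgs_exp_eq_inst σ k h.1, Ty.exp_eq_inst σ k (d + 1) h.2]
      rfl

omit [DecidableEq R] in
-- Passing under a binder shifts `N`, which does nothing to a ground term, so the same substitution
-- continues at `d + 1`. Only the base simple type arises, since every `Π` binds an atomic type.
theorem Ty.hsub_inst {k : ℕ} {ρ : List (ℕ → Tm C)} (hρ : ∀ M ∈ ρ, IsGround M)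
    {N : ℕ → Tm C} (hN : IsGround N) :
    ∀ {A : Ty F (FSpine C R)} (d : ℕ), A.FO →
      (A.inst ρ k (d + 1)).hsub .base k (N k) d = some (A.inst (N :: ρ) k d)
  | .atom a S, d, h => by
      simp only [Ty.FO] at h
      simp only [Ty.inst, Ty.hsub, Spine.hsub]
      rw [FSpine.hsubWith_inst (fun k => (hN k).2) (hsubWith_env hρ hN) k h]
      rfl
  | .pi (.atom a S) B, d, h => by
      simp only [Ty.FO] at h
      simp only [Ty.inst, Ty.hsub, Spine.hsub]
      rw [FSpine.hsubWith_inst (fun k => (hN k).2) (hsubWith_env hρ hN) k h.1,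
        (hN k).1.shift_eq, Ty.hsub_inst hρ hN (d + 1) h.2]
      rfl

/-! ### Checking instances of first-order declarations -/

/-- `D` is checked at depth `k`, in the empty context, against the atomic type `a · Ts`. -/
def TypedAt (σ : Sig F C R) (k : ℕ) (a : F) (Ts : List (ℕ → Tm C)) (D : ℕ → Tm C) : Prop :=
  Chk σ k [] (D k) (.atom a (Spine.ofList (Ts.map fun N => N (k - 1))))

/-- The arguments `Ms` match, at depth `k`, the type `A` of a constructor, with result `a · Ts`;
the variables that are already instantiated are given by `ρ`. -/
def MatchAt (σ : Sig F C R) (k : ℕ) (a : F) (Ts : List (ℕ → Tm C)) :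
    List (ℕ → Tm C) → List (ℕ → Tm C) → Ty F (FSpine C R) → Prop
  | ρ, Ms, .atom b S => Ms = [] ∧ b = a ∧ (S.inst (env 0 ρ)).map (· k) = Ts.map (· k)
  | ρ, Ms, .pi (.atom b S) B =>
      ∃ N Ms', Ms = N :: Ms' ∧ TypedAt σ k b (S.inst (env 0 ρ)) N ∧ MatchAt σ k a Ts (N :: ρ) Ms' B
  | _, _, .pi (.pi _ _) _ => False

/-- The arguments `Ms` match at all depths. -/
def Matches (σ : Sig F C R) (a : F) (Ts : List (ℕ → Tm C)) :
    List (ℕ → Tm C) → List (ℕ → Tm C) → Ty F (FSpine C R) → Prop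
  | ρ, Ms, .atom b S => Ms = [] ∧ b = a ∧ S.inst (env 0 ρ) = Ts
  | ρ, Ms, .pi (.atom b S) B =>
      ∃ N Ms', Ms = N :: Ms' ∧ (∀ k, TypedAt σ k b (S.inst (env 0 ρ)) N) ∧
        Matches σ a Ts (N :: ρ) Ms' B
  | _, _, .pi (.pi _ _) _ => False

/-- The arguments are fixed infinite terms, independent of `k`, so the quantifier over depths moves
inside the existentials. -/
theorem matches_of_forall {σ : Sig F C R} {a : F} {Ts : List (ℕ → Tm C)} :
    ∀ {ρ Ms : List (ℕ → Tm C)} {A : Ty F (FSpine C R)},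
      (∀ k, MatchAt σ k a Ts ρ Ms A) → Matches σ a Ts ρ Ms A
  | _, _, .atom _ _, h => by
      simp only [MatchAt, Matches] at h ⊢
      exact ⟨(h 0).1, (h 0).2.1, ext_of_map_eval fun k => (h k).2.2⟩
  | _, [], .pi (.atom _ _) _, h => by simp [MatchAt] at h
  | _, N :: Ms, .pi (.atom _ _) _, h => by
      have h' : ∀ k, TypedAt σ k _ _ N ∧ MatchAt σ k a Ts (N :: _) Ms _ := fun k => by
        have := h k
        simp only [MatchAt, List.cons.injEq] at this
        obtain ⟨_, _, ⟨rfl, rfl⟩, h⟩ := this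
        exact h
      exact ⟨N, Ms, rfl, fun k => (h' k).1, matches_of_forall fun k => (h' k).2⟩
  | _, _, .pi (.pi _ _) _, h => by simp [MatchAt] at h

/-- Induction on the type. Each argument is checked against the instance of its type under the
arguments already read, and is then pushed onto the assignment. The result index is compared up to
truncation, as in the rule `neutral`. -/
theorem chkSusp_inst {σ : Sig F C R} {k : ℕ} {a : F} {Ts : List (ℕ → Tm C)} :
    ∀ {A : Ty F (FSpine C R)} {ρ Ms : List (ℕ → Tm C)}, A.FO →
      (∀ M ∈ ρ, IsGround M) → (∀ M ∈ Ms, IsGround M) →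
      ((∃ S, ChkSusp σ (k + 1) [] (Spine.ofList (Ms.map (· k))) (A.inst ρ k 0) a S ∧
        S.trunc k = Spine.ofList (Ts.map (· k))) ↔ MatchAt σ k a Ts ρ Ms A)
  | .atom b S, ρ, Ms, _, hρ, _ => by
      have e : (Spine.ofList ((S.inst (env 0 ρ)).map (· k))).trunc k =
          Spine.ofList ((S.inst (env 0 ρ)).map (· k)) := by
        rw [← FSpine.trunc_inst (trunc_env hρ) k, ← Spine.trunc_ofList, Spine.trunc_trunc_self]
      simp only [Ty.inst, MatchAt]
      constructor
      · rintro ⟨S₁, h, hS⟩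
        generalize hS' : Spine.ofList (Ms.map (· k)) = S' at h
        cases h
        rw [e] at hS
        refine ⟨?_, rfl, Spine.ofList_injective hS⟩
        cases Ms with
        | nil => rfl
        | cons M Ms => simp [Spine.ofList] at hS'
      · rintro ⟨rfl, rfl, h⟩
        exact ⟨_, .nil _ _ _ _, by rw [e, h]⟩
  | .pi (.atom b S) B, ρ, Ms, h, hρ, hMs => by
      simp only [Ty.FO] at h
      -- The rule truncates an argument type whose indices have depth `k` down to depth `k - 1`;
      -- coherence of the assignment makes this the next lower observation. At depth `0` checking is
      -- vacuous, so nothing is needed.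
      have key : ((Ty.atom b S).inst ρ k 0).trunc k =
          .atom b (Spine.ofList ((S.inst (env 0 ρ)).map fun N => N (k - 1))) ∨ k = 0 := by
        cases k with
        | zero => exact .inr rfl
        | succ k =>
          left
          simp only [Ty.inst, Ty.trunc, Spine.trunc_ofList, Nat.add_sub_cancel]
          rw [← FSpine.trunc_inst (trunc_env hρ) k]
      have key' : ∀ N, Chk σ k [] N (((Ty.atom b S).inst ρ k 0).trunc k) ↔
          Chk σ k [] N (.atom b (Spine.ofList ((S.inst (env 0 ρ)).map fun N => N (k - 1)))) := by
        intro N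
        rcases key with h | rfl
        · rw [h]
        · exact ⟨fun _ => .zero _ _ _, fun _ => .zero _ _ _⟩
      simp only [MatchAt]
      constructor
      · rintro ⟨S₁, hc, hS⟩
        cases Ms with
        | nil => simp only [Spine.ofList, List.map_nil, Ty.inst] at hc; cases hc
        | cons N Ms =>
          simp only [List.mem_cons, forall_eq_or_imp] at hMs
          simp only [Spine.ofList, List.map_cons] at hc
          rw [Ty.inst] at hc
          cases hc with
          | cons _ _ _ _ _ A' _ _ _ h1 h2 h3 =>
            refine ⟨N, Ms, rfl, (key' _).1 h1, ?_⟩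
            have e : (Ty.inst ρ k 0 (Ty.atom b S)).erase = .base := rfl
            rw [e, Ty.hsub_inst hρ hMs.1 0 h.2] at h2
            cases h2
            exact (chkSusp_inst h.2 (by simpa using ⟨hMs.1, hρ⟩) hMs.2).1 ⟨_, h3, hS⟩
      · rintro ⟨N, Ms, rfl, h1, h2⟩
        simp only [List.mem_cons, forall_eq_or_imp] at hMs
        simp only [Spine.ofList, List.map_cons]
        rw [Ty.inst]
        obtain ⟨S₁, h3, h4⟩ := (chkSusp_inst h.2 (by simpa using ⟨hMs.1, hρ⟩) hMs.2).2 h2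
        exact ⟨S₁, .cons _ _ _ _ _ _ _ _ _ ((key' _).2 h1) (Ty.hsub_inst hρ hMs.1 0 h.2) h3, h4⟩

/-- Checking of a constructor whose type is first-order. -/
theorem typedAt_mk {σ : Sig F C R} {k : ℕ} {a : F} {Ts : List (ℕ → Tm C)} {c : C}
    {Ms : List (ℕ → Tm C)} {A : Ty F (FSpine C R)} (hA : ∀ A', Decl.con c A' ∈ σ ↔ A' = A)
    (hFO : A.FO) (hTs : ∀ T ∈ Ts, IsGround T) (hMs : ∀ M ∈ Ms, IsGround M) :
    TypedAt σ (k + 1) a Ts (mk c Ms) ↔ MatchAt σ k a Ts [] Ms A := by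
  rw [← chkSusp_inst hFO (by simp) hMs]
  simp only [TypedAt, mk, Nat.add_sub_cancel]
  -- Types are compared after truncation; on ground indices of depth `k` this is the identity, so
  -- the comparison is plain equality.
  have hTk : (Spine.ofList (Ts.map (· k))).trunc k = Spine.ofList (Ts.map (· k)) := by
    apply Spine.Ground.trunc_self
    rw [Spine.ground_ofList]
    intro M hM
    obtain ⟨T, hT, rfl⟩ := List.mem_map.1 hM
    exact (hTs T hT k).1
  constructor
  · intro h
    cases h with
    | neutral _ _ _ _ a' _ S' h1 h2 =>
      cases h1 with
      | con _ _ _ _ A' _ _ h3 h4 =>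
        obtain ⟨A₀, h5, h6⟩ := h3
        rw [hA] at h5
        subst h5
        rw [Ty.exp_eq_inst σ k 0 hFO] at h6
        cases h6
        simp only [Ty.trunc, Nat.add_sub_cancel, Ty.atom.injEq] at h2
        obtain ⟨rfl, h2⟩ := h2
        exact ⟨S', h4, h2.trans hTk⟩
  · rintro ⟨S', h, hS⟩
    refine .neutral _ _ _ _ _ _ _
      (.con _ _ _ _ _ _ _ ⟨A, (hA A).2 rfl, Ty.exp_eq_inst σ k 0 hFO⟩ h) ?_
    simp only [Ty.trunc, Nat.add_sub_cancel, hS, hTk]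

/-! ### Well-typed closed terms over a first-order signature are ground -/

/-- Types `Π x₁ : a₁ · S₁. … Π xₙ : aₙ · Sₙ. a · S`. -/
def Ty.FirstOrder {S : Type} : Ty F S → Prop
  | .atom _ _ => True
  | .pi (.atom _ _) B => B.FirstOrder
  | .pi (.pi _ _) _ => False

theorem Ty.exp_target {σ : Sig F C R} {k : ℕ} :
    ∀ {A : Ty F (FSpine C R)} {A' : Ty F (Spine C)}, A.exp σ k = some A' → A'.target = A.target
  | .atom a S, A', h => by
      simp only [Ty.exp, Option.map_eq_some_iff] at h
      obtain ⟨_, _, rfl⟩ := h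
      rfl
  | .pi A B, A', h => by
      simp only [Ty.exp, Option.bind_eq_some_iff, Option.map_eq_some_iff] at h
      obtain ⟨_, _, _, hB, rfl⟩ := h
      have := Ty.exp_target hB
      exact this

theorem Ty.FirstOrder.exp {σ : Sig F C R} {k : ℕ} :
    ∀ {A : Ty F (FSpine C R)} {A' : Ty F (Spine C)}, A.FirstOrder → A.exp σ k = some A' →
      A'.FirstOrder
  | .atom a S, A', _, h => by
      simp only [Ty.exp, Option.map_eq_some_iff] at h
      obtain ⟨_, _, rfl⟩ := h
      trivial
  | .pi (.atom a S) B, A', hf, h => by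
      simp only [Ty.exp, Option.bind_eq_some_iff, Option.map_eq_some_iff] at h
      obtain ⟨_, ⟨_, _, rfl⟩, _, hB, rfl⟩ := h
      have := Ty.FirstOrder.exp (A := B) hf hB
      exact this

omit [DecidableEq R] in
theorem Ty.hsub_target {τ : STy} {k : ℕ} :
    ∀ {A A' : Ty F (Spine C)} {N : Tm C} {x : ℕ}, A.hsub τ k N x = some A' → A'.target = A.target
  | .atom a S, A', _, _, h => by
      simp only [Ty.hsub, Option.map_eq_some_iff] at h
      obtain ⟨_, _, rfl⟩ := h
      rfl
  | .pi A B, A', _, _, h => by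
      simp only [Ty.hsub, Option.bind_eq_some_iff, Option.map_eq_some_iff] at h
      obtain ⟨_, _, _, hB, rfl⟩ := h
      have := Ty.hsub_target hB
      exact this

omit [DecidableEq R] in
theorem Ty.FirstOrder.hsub {τ : STy} {k : ℕ} :
    ∀ {A A' : Ty F (Spine C)} {N : Tm C} {x : ℕ}, A.FirstOrder → A.hsub τ k N x = some A' →
      A'.FirstOrder
  | .atom a S, A', _, _, _, h => by
      simp only [Ty.hsub, Option.map_eq_some_iff] at h
      obtain ⟨_, _, rfl⟩ := h
      trivial
  | .pi (.atom a S) B, A', _, _, hf, h => by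
      simp only [Ty.hsub, Option.bind_eq_some_iff, Option.map_eq_some_iff] at h
      obtain ⟨_, ⟨_, _, rfl⟩, _, hB, rfl⟩ := h
      have := Ty.FirstOrder.hsub (A := B) hf hB
      exact this

theorem ChkSusp.target_eq {σ : Sig F C R} {k : ℕ} {Γ : List (Ty F (Spine C))} {a : F}
    {S : Spine C} : ∀ {S' : Spine C} {A : Ty F (Spine C)},
      ChkSusp σ (k + 1) Γ S' A a S → A.target = a
  | .nil, _, h => by cases h; rfl
  | .cons _ _, _, h => by
      cases h with
      | cons _ _ _ _ _ _ _ _ _ _ h2 h3 =>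
        rw [Ty.target, ← Ty.hsub_target h2]
        exact ChkSusp.target_eq h3

theorem ChkSusp.ground {σ : Sig F C R} {k : ℕ} {a : F} {S : Spine C}
    (ih : ∀ {M : Tm C} {b : F} {T : Spine C},
      Chk σ k [] M (.atom b T) → M.HasDepth k → M.Ground k) :
    ∀ {S' : Spine C} {A : Ty F (Spine C)}, A.FirstOrder → ChkSusp σ (k + 1) [] S' A a S →
      S'.HasDepth k → S'.Ground k
  | .nil, _, _, _, _ => by simp [Spine.Ground]
  | .cons _ _, .pi (.atom _ _) B, hf, h, hd => by
      simp only [Spine.HasDepth, Spine.Ground] at hd ⊢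
      cases h with
      | cons _ _ _ _ _ _ _ _ _ h1 h2 h3 =>
        exact ⟨ih h1 hd.1, ChkSusp.ground ih (Ty.FirstOrder.hsub (A := B) hf h2) h3 hd.2⟩

/-- The empty context leaves no variable to serve as head, and an atomic type rules out an
abstraction. First-order constructor types make every argument type atomic again, so induction on
the depth applies. Only the shape of the types matters here, so recursion constants among their
indices are harmless. -/
theorem Chk.ground {σ : Sig F C R} (hσ : ∀ c A, Decl.con c A ∈ σ → A.FirstOrder) {k : ℕ} :
    ∀ {M : Tm C} {a : F} {S : Spine C},
      Chk σ k [] M (.atom a S) → M.HasDepth k → M.Ground k := by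
  induction k with
  | zero =>
    intro M _ _ _ h
    cases M <;> simp_all [Tm.HasDepth, Tm.Ground]
  | succ k ih =>
    intro M a S h hd
    cases h with
    | neutral _ _ _ _ _ _ _ h1 _ =>
      cases h1 with
      | var _ _ _ _ _ _ _ h => simp at h
      | con _ _ _ _ _ _ _ hc hs =>
        obtain ⟨A₀, h1, h2⟩ := hc
        simp only [Tm.HasDepth, Tm.Ground] at hd ⊢
        exact ChkSusp.ground ih ((hσ _ _ h1).exp h2) hs hd

theorem TypedAt.exists_target {σ : Sig F C R} {k : ℕ} {a : F} {Ts : List (ℕ → Tm C)} {c : C}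
    {Ms : List (ℕ → Tm C)} (h : TypedAt σ (k + 1) a Ts (mk c Ms)) :
    ∃ A, Decl.con c A ∈ σ ∧ A.target = a := by
  simp only [TypedAt, mk] at h
  cases h with
  | neutral _ _ _ _ _ _ _ h1 h2 =>
    cases h1 with
    | con _ _ _ _ _ _ _ hc hs =>
      obtain ⟨A₀, h3, h4⟩ := hc
      simp only [Ty.trunc, Ty.atom.injEq] at h2
      exact ⟨A₀, h3, by rw [← Ty.exp_target h4, hs.target_eq, h2.1]⟩

end Inst

/-! ### The signature: declarations, priorities, canonical terms -/

/-- The type of a constructor in `sig`. -/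
def conTy : Con → Ty Fam (FSpine Con Rec)
  | .cozero => at' .conat []
  | .cosucc => pis [at' .conat []] (at' .conat [])
  | .b0 => pis [at' .cobin []] (at' .cobin [])
  | .b1 => pis [at' .cobin []] (at' .cobin [])
  | .bsucc_0 => pis [at' .cobin []] (at' .bsucc [cn .b0 [v 0], cn .b1 [v 0]])
  | .bsucc_1 => pis [at' .cobin [], at' .cobin [], at' .bsucc [v 1, v 0]]
      (at' .bsucc [cn .b1 [v 2], cn .b0 [v 1]])
  | .coplus_0 => pis [at' .conat []] (at' .coplus [cn .cozero [], v 0, v 0])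
  | .coplus_1 => pis [at' .conat [], at' .conat [], at' .conat [], at' .coplus [v 2, v 1, v 0]]
      (at' .coplus [cn .cosucc [v 3], v 2, cn .cosucc [v 1]])
  | .tobin_0 => at' .tobin [cn .cozero [], rc .bzero]
  | .tobin_1 => pis [at' .conat [], at' .cobin [], at' .cobin [], at' .tobin [v 2, v 1],
      at' .bsucc [v 2, v 1]] (at' .tobin [cn .cosucc [v 4], v 2])
  | .frombin_0 => pis [at' .cobin [], at' .conat [], at' .conat [], at' .frombin [v 2, v 1],
      at' .coplus [v 2, v 2, v 1]] (at' .frombin [cn .b0 [v 4], v 2])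
  | .frombin_1 => pis [at' .cobin [], at' .conat [], at' .conat [], at' .frombin [v 2, v 1],
      at' .coplus [v 2, v 2, v 1]] (at' .frombin [cn .b1 [v 4], cn .cosucc [v 2]])
  | .bplus_00 => pis [at' .cobin [], at' .cobin [], at' .cobin [], at' .bplus [v 2, v 1, v 0]]
      (at' .bplus [cn .b0 [v 3], cn .b0 [v 2], cn .b0 [v 1]])
  | .bplus_01 => pis [at' .cobin [], at' .cobin [], at' .cobin [], at' .bplus [v 2, v 1, v 0]]
      (at' .bplus [cn .b0 [v 3], cn .b1 [v 2], cn .b1 [v 1]])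
  | .bplus_10 => pis [at' .cobin [], at' .cobin [], at' .cobin [], at' .bplus [v 2, v 1, v 0]]
      (at' .bplus [cn .b1 [v 3], cn .b0 [v 2], cn .b1 [v 1]])
  | .bplus_11 => pis [at' .cobin [], at' .cobin [], at' .cobin [], at' .cobin [],
      at' .bplus [v 3, v 2, v 1], at' .bsucc [v 2, v 1]]
      (at' .bplus [cn .b1 [v 5], cn .b1 [v 4], cn .b0 [v 2]])
  | .eqconat_0 => at' .eqconat [cn .cozero [], cn .cozero []]
  | .eqconat_1 => pis [at' .conat [], at' .conat [], at' .eqconat [v 1, v 0]]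
      (at' .eqconat [cn .cosucc [v 2], cn .cosucc [v 1]])
  | .eqconat_refl_0 => at' .eqconat_refl [cn .cozero [], cn .eqconat_0 []]
  | .eqconat_refl_1 => pis [at' .conat [], at' .eqconat [v 0, v 0], at' .eqconat_refl [v 1, v 0]]
      (at' .eqconat_refl [cn .cosucc [v 2], cn .eqconat_1 [v 2, v 2, v 1]])
  | .bsucc_sound_0 => pis [at' .cobin [], at' .conat [], at' .conat [], at' .frombin [v 2, v 1],
      at' .coplus [v 2, v 2, v 1], at' .eqconat [v 2, v 2], at' .eqconat_refl [v 3, v 0]]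
      (at' .bsucc_sound [cn .b0 [v 6], cn .b1 [v 6], v 4, cn .cosucc [v 4],
        cn .frombin_0 [v 6, v 5, v 4, v 3, v 2], cn .frombin_1 [v 6, v 5, v 4, v 3, v 2],
        cn .bsucc_0 [v 6], cn .eqconat_1 [v 4, v 4, v 1]])
  | .bsucc_sound_1 => pis [at' .cobin [], at' .cobin [], at' .conat [], at' .conat [],
      at' .frombin [v 3, v 1], at' .frombin [v 3, v 1], at' .bsucc [v 5, v 4],
      at' .eqconat [cn .cosucc [v 4], v 3], at' .coplus [v 5, v 5, v 5],
      at' .coplus [v 5, v 5, cn .cosucc [v 5]],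
      at' .bsucc_sound [v 9, v 8, v 7, v 6, v 5, v 4, v 3, v 2]]
      (at' .bsucc_sound [cn .b1 [v 10], cn .b0 [v 9], cn .cosucc [v 8], cn .cosucc [v 7],
        cn .frombin_1 [v 10, v 8, v 8, v 6, v 2],
        cn .frombin_0 [v 9, v 7, cn .cosucc [v 7], v 5, v 1],
        cn .bsucc_1 [v 10, v 9, v 4], cn .eqconat_1 [cn .cosucc [v 8], v 7, v 3]])

theorem con_mem_sig {c : Con} {A : Ty Fam (FSpine Con Rec)} :
    Decl.con c A ∈ sig ↔ A = conTy c := by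
  cases c <;>
    simp only [sig, conTy, List.mem_cons, List.not_mem_nil, Decl.con.injEq, reduceCtorEq,
      false_and, true_and, false_or, or_false]

theorem conTy_firstOrder (c : Con) : (conTy c).FirstOrder := by
  cases c <;> trivial

/-- The position of the declaration of a type family. -/
def famPos : Fam → ℕ
  | .conat => 0
  | .cobin => 3
  | .bsucc => 10
  | .coplus => 13
  | .tobin => 16
  | .frombin => 19
  | .bplus => 22
  | .eqconat => 29
  | .eqconat_refl => 32
  | .bsucc_sound => 35

theorem sig_famPos (a : Fam) : ∃ K, sig[famPos a]? = some (.fam a K) ∧ K.IsCotype := by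
  cases a <;> exact ⟨_, rfl, trivial⟩

theorem sig_coinductive (c : Con) : sig.Coinductive c := by
  obtain ⟨K, h, hK⟩ := sig_famPos (conTy c).target
  exact ⟨conTy c, K, con_mem_sig.2 rfl, List.mem_of_getElem? h, hK⟩

theorem sig_hasPriority (c : Con) : sig.HasPriority c (famPos (conTy c).target) := by
  obtain ⟨K, h, -⟩ := sig_famPos (conTy c).target
  exact ⟨conTy c, K, con_mem_sig.2 rfl, h⟩

-- Trace-validity and canonicity of ground terms

instance : Finite Con :=
  Finite.of_injective (β := Fin 22)
    (fun c => ⟨c.ctorIdx, by cases c <;> simp [Con.ctorIdx]⟩) (by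
      intro c c' h
      cases c <;> cases c' <;> first | rfl | (simp [Con.ctorIdx] at h))

/-- Every head on a trace is one of finitely many constructors, so some constructor recurs
infinitely often. Among the recurring ones, one of maximal priority is coinductive because every
family of the signature is. -/
theorem IsGround.traceValid {D : ℕ → Tm Con} (hD : IsGround D) : sig.TraceValid D := by
  rintro h ⟨p, hp⟩
  have hcon : ∀ n, ∃ c, h n = .con c := fun n => by
    obtain ⟨k, hk⟩ := hp n
    exact (hD k).1.headAt_eq hk
  have hne : {c : Con | ∃ᶠ n in Filter.atTop, h n = .con c}.Nonempty := by
    by_contra hcontra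
    have : ∀ c : Con, ∀ᶠ n in Filter.atTop, h n ≠ .con c := by
      intro c
      by_contra hc
      exact hcontra ⟨c, hc⟩
    obtain ⟨n, hn⟩ := (Filter.eventually_all.2 this).exists
    obtain ⟨c, hc⟩ := hcon n
    exact hn c hc
  obtain ⟨c, hc, hmax⟩ := Set.exists_max_image _ (fun c => famPos (conTy c).target)
    (Set.toFinite _) hne
  exact ⟨c, sig_coinductive c, hc, fun c' hc' =>
    ⟨_, _, sig_hasPriority c', sig_hasPriority c, hmax c' hc'⟩⟩

/-- Ground and well-typed at all depths. -/
structure Can (a : Fam) (Ts : List (ℕ → Tm Con)) (D : ℕ → Tm Con) : Prop where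
  ground : IsGround D
  typed : ∀ k, TypedAt sig k a Ts D

/-- Typing already forces groundness, and groundness already gives trace-validity. -/
theorem canonical_iff {a : Fam} {Ts : List (ℕ → Tm Con)} {D : ℕ → Tm Con} :
    sig.Canonical a Ts D ↔ Can a Ts D := by
  constructor
  · rintro ⟨h1, h2, -⟩
    refine ⟨fun k => ⟨(h2 k).ground ?_ (h1 k).1, (h1 k).2⟩, h2⟩
    intro c A h
    rw [con_mem_sig.1 h]
    exact conTy_firstOrder c
  · rintro ⟨h1, h2⟩
    exact ⟨h1.isInfTm, h2, h1.traceValid⟩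

theorem TypedAt.zero (a : Fam) (Ts : List (ℕ → Tm Con)) (D : ℕ → Tm Con) :
    TypedAt sig 0 a Ts D := Chk.zero _ _ _

theorem typedAt_succ {k : ℕ} {a : Fam} {Ts : List (ℕ → Tm Con)} {c : Con}
    {Ms : List (ℕ → Tm Con)} (hFO : (conTy c).FO) (hTs : ∀ T ∈ Ts, IsGround T)
    (hMs : ∀ M ∈ Ms, IsGround M) :
    TypedAt sig (k + 1) a Ts (mk c Ms) ↔ MatchAt sig k a Ts [] Ms (conTy c) :=
  typedAt_mk (fun _ => con_mem_sig) hFO hTs hMs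

/-- Inversion: the head of a canonical term is a constructor of its type family. -/
theorem Can.exists_matches {a : Fam} {Ts : List (ℕ → Tm Con)} {D : ℕ → Tm Con}
    (h : Can a Ts D) (hTs : ∀ T ∈ Ts, IsGround T) (hFO : ∀ c, (conTy c).target = a → (conTy c).FO) :
    ∃ c Ms, D = CoLF.mk c Ms ∧ (∀ M ∈ Ms, IsGround M) ∧ (conTy c).target = a ∧
      Matches sig a Ts [] Ms (conTy c) := by
  obtain ⟨c, Ms, hMs, rfl⟩ := h.ground.exists_mk
  -- Depth `1` already shows the head, hence its family.
  obtain ⟨A, hA, ht⟩ := (h.typed 1).exists_target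
  rw [con_mem_sig.1 hA] at ht
  exact ⟨c, Ms, rfl, hMs, ht, matches_of_forall fun k =>
    (typedAt_succ (hFO c ht) hTs hMs).1 (h.typed (k + 1))⟩

/-- Each unfolding is guarded by a constructor, so induction on the depth suffices; arguments
already known to be ground need not satisfy `P`. -/
theorem IsGround.coinduction {P : (ℕ → Tm Con) → Prop}
    (hP : ∀ D, P D → ∃ c Ms, D = CoLF.mk c Ms ∧ ∀ M ∈ Ms, P M ∨ IsGround M) {D : ℕ → Tm Con}
    (hD : P D) : IsGround D := by
  intro k
  induction k generalizing D with
  | zero =>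
    obtain ⟨c, Ms, rfl, -⟩ := hP D hD
    simp [CoLF.mk, Tm.Ground, Tm.trunc]
  | succ k ih =>
    obtain ⟨c, Ms, rfl, hMs⟩ := hP D hD
    have h' : ∀ M ∈ Ms, (M k).Ground k ∧ (M (k + 1)).trunc k = M k := fun M hM =>
      (hMs M hM).elim (fun h => ih h) (fun h => h k)
    simp only [CoLF.mk, Tm.Ground, Spine.ground_ofList, Tm.trunc, Spine.trunc_ofList,
      List.map_map, List.mem_map, forall_exists_index, and_imp, forall_apply_eq_imp_iff₂]
    refine ⟨fun M hM => (h' M hM).1, ?_⟩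
    congr 2
    exact List.map_congr_left fun M hM => (h' M hM).2

/-! ### Encodings of numbers -/

theorem encCobin_eq (N : Cobin) :
    encCobin N = mk (if N.head then .b1 else .b0) [encCobin N.tail] := by
  funext k; cases k <;> rfl

@[simp]
theorem encCobin_b0 (N : Cobin) : encCobin N.b0 = mk .b0 [encCobin N] := by
  rw [encCobin_eq]; rfl

@[simp]
theorem encCobin_b1 (N : Cobin) : encCobin N.b1 = mk .b1 [encCobin N] := by
  rw [encCobin_eq]; rfl

theorem Cobin.cases (N : Cobin) : (∃ X : Cobin, N = X.b0) ∨ ∃ X : Cobin, N = X.b1 := by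
  cases h : N.head
  · exact .inl ⟨N.tail, by rw [Cobin.b0, ← h, Stream'.eta]⟩
  · exact .inr ⟨N.tail, by rw [Cobin.b1, ← h, Stream'.eta]⟩

@[simp]
theorem encConat_zero : encConat 0 = mk .cozero [] := by
  funext k; cases k <;> simp [encConat, mk]

@[simp]
theorem encConat_succ (X : ℕ∞) : encConat (X + 1) = mk .cosucc [encConat X] := by
  funext k
  cases k with
  | zero => rfl
  | succ k =>
    have h1 : X + 1 ≠ 0 := by simp
    have h2 : X + 1 - 1 = X := by
      cases X with
      | top => rfl
      | coe n => norm_cast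
    simp [encConat, mk, h2]

theorem conat_cases (X : ℕ∞) : X = 0 ∨ ∃ Y, X = Y + 1 := by
  cases X with
  | top => exact .inr ⟨⊤, rfl⟩
  | coe n =>
    cases n with
    | zero => exact .inl rfl
    | succ n => exact .inr ⟨n, by push_cast; rfl⟩

theorem isGround_encCobin (N : Cobin) : IsGround (encCobin N) := by
  refine IsGround.coinduction (P := fun D => ∃ N, D = encCobin N) ?_ ⟨N, rfl⟩
  rintro _ ⟨N, rfl⟩
  exact ⟨_, _, encCobin_eq N, by simp⟩

theorem isGround_encConat (X : ℕ∞) : IsGround (encConat X) := by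
  refine IsGround.coinduction (P := fun D => ∃ X, D = encConat X) ?_ ⟨X, rfl⟩
  rintro _ ⟨X, rfl⟩
  rcases conat_cases X with rfl | ⟨Y, rfl⟩
  · exact ⟨_, _, encConat_zero, by simp⟩
  · exact ⟨_, _, encConat_succ Y, by simp⟩

theorem encCobin_injective : Function.Injective encCobin := by
  intro N M h
  apply Stream'.ext
  intro n
  induction n generalizing N M with
  | zero =>
    rcases N.cases with ⟨X, rfl⟩ | ⟨X, rfl⟩ <;> rcases M.cases with ⟨Y, rfl⟩ | ⟨Y, rfl⟩ <;>
      simp_all [Stream'.cons, Stream'.get]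
  | succ n ih =>
    rcases N.cases with ⟨X, rfl⟩ | ⟨X, rfl⟩ <;> rcases M.cases with ⟨Y, rfl⟩ | ⟨Y, rfl⟩ <;>
      simp only [encCobin_b0, encCobin_b1, mk_inj, List.cons.injEq, and_true, reduceCtorEq,
        false_and, true_and] at h
    · exact ih h
    · exact ih h

/-- A finite conatural is determined by its encoding, by induction. Infinity is the only other
value, so its encoding cannot coincide with a finite one. -/
theorem encConat_injective : Function.Injective encConat := by
  have key : ∀ (n : ℕ) (X : ℕ∞), encConat X = encConat n → X = n := by
    intro n
    induction n with
    | zero =>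
      intro X h
      rcases conat_cases X with rfl | ⟨Y, rfl⟩
      · rfl
      · simp at h
    | succ n ih =>
      intro X h
      push_cast at h ⊢
      rcases conat_cases X with rfl | ⟨Y, rfl⟩
      · simp at h
      · simp only [encConat_succ, mk_inj, List.cons.injEq, and_true, true_and] at h
        rw [ih Y h]
  intro X Y h
  cases Y with
  | coe n => exact key n X h
  | top =>
    cases X with
    | top => rfl
    | coe n => exact (key n ⊤ h.symm).symm

/-! ### Possibly infinite derivations: subderivations and unfolding -/

section Deriv
variable {J : Type} {R : Rules J}

/-- The immediate subderivation number `n`. -/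
def Deriv.sub {j j' : J} (d : Deriv R j) {i : R.Inst} (hi : d.node [] = some i) (n : ℕ)
    (h : (R.prems i)[n]? = some j') : Deriv R j' where
  node := subtree d.node n
  root := (d.step [] i hi n).trans h
  step p := d.step (n :: p)
  none p := d.none (n :: p)

theorem Deriv.exists_root {j : J} (d : Deriv R j) : ∃ i, d.node [] = some i ∧ R.concl i = j := by
  simpa only [Option.map_eq_some_iff] using d.root

/-- A derivation is a total function on addresses, so equality of derivations also involves
addresses below missing premises. Emptiness propagates from a prefix to its extensions, hence the
induction from the end of the address. -/
theorem Deriv.node_cons_eq_none {j : J} (d : Deriv R j) {i : R.Inst} (hi : d.node [] = some i)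
    {n : ℕ} (h : (R.prems i)[n]? = Option.none) (p : List ℕ) : d.node (n :: p) = Option.none := by
  induction p using List.reverseRecOn with
  | nil =>
    have := d.step [] i hi n
    rw [h] at this
    simpa using this
  | append_singleton p m ih => exact d.none (n :: p) m ih

/-- The tree unfolded from a state. -/
def unfold {I St : Type} (inst : St → I) (next : St → ℕ → Option St) : List ℕ → St → Option I
  | [], s => some (inst s)
  | n :: p, s => (next s n).bind (unfold inst next p)

/-- The derivation unfolded from a state. -/
def Deriv.unfold {St : Type} (inst : St → R.Inst) (next : St → ℕ → Option St) (judg : St → J)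
    (hc : ∀ s, R.concl (inst s) = judg s)
    (hp : ∀ s n, (next s n).map judg = (R.prems (inst s))[n]?) (s : St) : Deriv R (judg s) where
  node p := CoLF.unfold inst next p s
  root := by simp [CoLF.unfold, hc]
  step p := by
    induction p generalizing s with
    | nil =>
      intro i h n
      simp only [CoLF.unfold, Option.some.injEq] at h
      subst h
      rw [← hp]
      cases h : next s n <;> simp [CoLF.unfold, h, hc]
    | cons m p ih =>
      intro i h n
      cases hm : next s m with
      | none => simp [CoLF.unfold, hm] at h
      | some s' =>
        simp only [CoLF.unfold, hm, Option.bind_some, List.cons_append] at h ⊢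
        exact ih s' i h n
  none p := by
    induction p generalizing s with
    | nil => intro n h; simp [CoLF.unfold] at h
    | cons m p ih =>
      intro n h
      cases hm : next s m with
      | none => simp [CoLF.unfold, hm]
      | some s' =>
        simp only [CoLF.unfold, hm, Option.bind_some, List.cons_append] at h ⊢
        exact ih s' n h

end Deriv

/-! ### Encodings of derivations about numbers -/

/-- The encoding of a rule instance, given the encodings of the derivations of its premises. -/
def RuleInst.enc (s : ℕ → ℕ → Tm Con) : RuleInst → ℕ → Tm Con
  | .bsucc_0 X => mk .bsucc_0 [encCobin X]
  | .bsucc_1 X Y => mk .bsucc_1 [encCobin X, encCobin Y, s 0]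
  | .coplus_0 Y => mk .coplus_0 [encConat Y]
  | .coplus_1 X Y Z => mk .coplus_1 [encConat X, encConat Y, encConat Z, s 0]
  | .frombin_0 X Y Z => mk .frombin_0 [encCobin X, encConat Y, encConat Z, s 0, s 1]
  | .frombin_1 X Y Z => mk .frombin_1 [encCobin X, encConat Y, encConat Z, s 0, s 1]
  | .eqconat_0 => mk .eqconat_0 []
  | .eqconat_1 X Y => mk .eqconat_1 [encConat X, encConat Y, s 0]

theorem encTree_eq {t : List ℕ → Option RuleInst} {i : RuleInst} (h : t [] = some i) :
    encTree t = i.enc fun n => encTree (subtree t n) := by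
  funext k
  cases k with
  | zero => cases i <;> rfl
  | succ k => cases i <;> simp [encTree, h, RuleInst.enc, mk]

/-- The form of the encoding of a derivation. -/
inductive Der.Shape : Judg → (ℕ → Tm Con) → Prop
  | bsucc_0 (X : Cobin) : Shape (.bsucc X.b0 X.b1) (mk .bsucc_0 [encCobin X])
  | bsucc_1 {X Y : Cobin} (d : Der (.bsucc X Y)) :
      Shape (.bsucc X.b1 Y.b0) (mk .bsucc_1 [encCobin X, encCobin Y, d.enc])
  | coplus_0 (Y : ℕ∞) : Shape (.coplus 0 Y Y) (mk .coplus_0 [encConat Y])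
  | coplus_1 {X Y Z : ℕ∞} (d : Der (.coplus X Y Z)) :
      Shape (.coplus (X + 1) Y (Z + 1))
        (mk .coplus_1 [encConat X, encConat Y, encConat Z, d.enc])
  | frombin_0 {X : Cobin} {Y Z : ℕ∞} (d : Der (.frombin X Y)) (d' : Der (.coplus Y Y Z)) :
      Shape (.frombin X.b0 Z)
        (mk .frombin_0 [encCobin X, encConat Y, encConat Z, d.enc, d'.enc])
  | frombin_1 {X : Cobin} {Y Z : ℕ∞} (d : Der (.frombin X Y)) (d' : Der (.coplus Y Y Z)) :
      Shape (.frombin X.b1 (Z + 1))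
        (mk .frombin_1 [encCobin X, encConat Y, encConat Z, d.enc, d'.enc])
  | eqconat_0 : Shape (.eqconat 0 0) (mk .eqconat_0 [])
  | eqconat_1 {X Y : ℕ∞} (d : Der (.eqconat X Y)) :
      Shape (.eqconat (X + 1) (Y + 1)) (mk .eqconat_1 [encConat X, encConat Y, d.enc])

theorem Der.shape {j : Judg} (d : Der j) : Der.Shape j d.enc := by
  obtain ⟨i, hi, rfl⟩ := d.exists_root
  rw [Der.enc, encTree_eq hi]
  cases i with
  | bsucc_0 X => exact .bsucc_0 X
  | bsucc_1 X Y => exact .bsucc_1 (d.sub hi 0 rfl)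
  | coplus_0 Y => exact .coplus_0 Y
  | coplus_1 X Y Z => exact .coplus_1 (d.sub hi 0 rfl)
  | frombin_0 X Y Z => exact .frombin_0 (d.sub hi 0 rfl) (d.sub hi 1 rfl)
  | frombin_1 X Y Z => exact .frombin_1 (d.sub hi 0 rfl) (d.sub hi 1 rfl)
  | eqconat_0 => exact .eqconat_0
  | eqconat_1 X Y => exact .eqconat_1 (d.sub hi 0 rfl)

theorem Der.isGround_enc {j : Judg} (d : Der j) : IsGround d.enc := by
  refine IsGround.coinduction (P := fun D => ∃ (j : Judg) (d : Der j), D = d.enc) ?_ ⟨j, d, rfl⟩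
  rintro _ ⟨j, d, rfl⟩
  have hN := isGround_encCobin
  have hX := isGround_encConat
  have hs := d.shape
  generalize d.enc = D at hs ⊢
  cases hs with
  | bsucc_0 => exact ⟨_, _, rfl, by simp [hN]⟩
  | bsucc_1 => exact ⟨_, _, rfl, by simpa [hN] using .inl ⟨_, _, rfl⟩⟩
  | coplus_0 => exact ⟨_, _, rfl, by simp [hX]⟩
  | coplus_1 => exact ⟨_, _, rfl, by simpa [hX] using .inl ⟨_, _, rfl⟩⟩
  | frombin_0 =>
    exact ⟨_, _, rfl, by simpa [hN, hX] using ⟨.inl ⟨_, _, rfl⟩, .inl ⟨_, _, rfl⟩⟩⟩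
  | frombin_1 =>
    exact ⟨_, _, rfl, by simpa [hN, hX] using ⟨.inl ⟨_, _, rfl⟩, .inl ⟨_, _, rfl⟩⟩⟩
  | eqconat_0 => exact ⟨_, _, rfl, by simp⟩
  | eqconat_1 => exact ⟨_, _, rfl, by simpa [hX] using .inl ⟨_, _, rfl⟩⟩

/-- All parameters of the rule instance are explicit arguments, and encodings of numbers are
injective. Nothing is claimed about positions that carry no premise. -/
theorem RuleInst.enc_inj {i i' : RuleInst} {s s' : ℕ → ℕ → Tm Con} (h : i.enc s = i'.enc s') :
    i = i' ∧ ∀ n, (i.prems[n]?).isSome → s n = s' n := by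
  cases i <;> cases i' <;>
    simp only [RuleInst.enc, mk_inj, List.cons.injEq, reduceCtorEq, false_and, and_true, true_and,
      encCobin_injective.eq_iff, encConat_injective.eq_iff] at h
  all_goals
    try (obtain ⟨rfl, rfl, rfl, h⟩ := h)
    try (obtain ⟨rfl, rfl, h⟩ := h)
    try subst h
    refine ⟨rfl, fun n hn => ?_⟩
    rcases n with _ | _ | n <;> simp_all [RuleInst.prems]

/-- Induction on the address: the root instance is read off the term, the subderivations at premises
have equal encodings, and elsewhere both trees are empty. Comparing bare node functions avoids
transport between types of derivations. -/
theorem Der.node_eq_of_enc_eq {j j' : Judg} {d : Der j} {d' : Der j'} (h : d.enc = d'.enc) :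
    d.node = d'.node := by
  funext p
  induction p generalizing j j' with
  | nil =>
    obtain ⟨i, hi, -⟩ := d.exists_root
    obtain ⟨i', hi', -⟩ := d'.exists_root
    rw [Der.enc, Der.enc, encTree_eq hi, encTree_eq hi'] at h
    rw [hi, hi', (RuleInst.enc_inj h).1]
  | cons n p ih =>
    obtain ⟨i, hi, -⟩ := d.exists_root
    obtain ⟨i', hi', -⟩ := d'.exists_root
    rw [Der.enc, Der.enc, encTree_eq hi, encTree_eq hi'] at h
    obtain ⟨rfl, h'⟩ := RuleInst.enc_inj h
    cases hn : (rules.prems i)[n]? with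
    | none => rw [d.node_cons_eq_none hi hn, d'.node_cons_eq_none hi' hn]
    | some j =>
      refine ih (d := d.sub hi n hn) (d' := d'.sub hi' n hn) (h' n ?_)
      exact Option.isSome_iff_exists.2 ⟨j, hn⟩

theorem Der.enc_injective {j : Judg} : Function.Injective (Der.enc (j := j)) :=
  fun _ _ h => Deriv.ext (Der.node_eq_of_enc_eq h)

@[simp]
theorem Der.enc_bsucc_0 (X : Cobin) : (Der.bsucc_0 X).enc = mk .bsucc_0 [encCobin X] :=
  encTree_eq (t := (Der.bsucc_0 X).node) (i := .bsucc_0 X) rfl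

@[simp]
theorem Der.enc_bsucc_1 {X Y : Cobin} (d : Der (.bsucc X Y)) :
    d.bsucc_1.enc = mk .bsucc_1 [encCobin X, encCobin Y, d.enc] :=
  encTree_eq (t := (d.bsucc_1).node) (i := .bsucc_1 X Y) rfl

@[simp]
theorem Der.enc_frombin_0 {X : Cobin} {Y Z : ℕ∞} (d : Der (.frombin X Y))
    (d' : Der (.coplus Y Y Z)) :
    (d.frombin_0 d').enc = mk .frombin_0 [encCobin X, encConat Y, encConat Z, d.enc, d'.enc] :=
  encTree_eq (t := (d.frombin_0 d').node) (i := .frombin_0 X Y Z) rfl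

@[simp]
theorem Der.enc_frombin_1 {X : Cobin} {Y Z : ℕ∞} (d : Der (.frombin X Y))
    (d' : Der (.coplus Y Y Z)) :
    (d.frombin_1 d').enc = mk .frombin_1 [encCobin X, encConat Y, encConat Z, d.enc, d'.enc] :=
  encTree_eq (t := (d.frombin_1 d').node) (i := .frombin_1 X Y Z) rfl

@[simp]
theorem Der.enc_eqconat_0 : Der.eqconat_0.enc = mk .eqconat_0 [] :=
  encTree_eq (t := (Der.eqconat_0).node) (i := .eqconat_0) rfl

@[simp]
theorem Der.enc_eqconat_1 {X Y : ℕ∞} (d : Der (.eqconat X Y)) :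
    d.eqconat_1.enc = mk .eqconat_1 [encConat X, encConat Y, d.enc] :=
  encTree_eq (t := (d.eqconat_1).node) (i := .eqconat_1 X Y) rfl

/-- Matching a soundness constructor yields arbitrary families as arguments. Once such families are
seen inside the encoding of a known derivation, this inversion and the next three identify them as
encodings. -/
theorem Der.exists_of_enc_bsucc_1 {N M : Cobin} {d : Der (.bsucc N M)} {x y e : ℕ → Tm Con}
    (h : d.enc = mk .bsucc_1 [x, y, e]) : ∃ (X Y : Cobin) (d' : Der (.bsucc X Y)),
      N = X.b1 ∧ M = Y.b0 ∧ x = encCobin X ∧ y = encCobin Y ∧ e = d'.enc := by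
  have hs := d.shape
  rw [h] at hs
  generalize hD : mk .bsucc_1 [x, y, e] = D at hs
  cases hs with
  | bsucc_0 => simp at hD
  | bsucc_1 d' =>
    simp only [mk_inj, List.cons.injEq, true_and, and_true] at hD
    exact ⟨_, _, d', rfl, rfl, hD⟩

theorem Der.exists_of_enc_eqconat_1 {X' Y' : ℕ∞} {d : Der (.eqconat X' Y')} {x y e : ℕ → Tm Con}
    (h : d.enc = mk .eqconat_1 [x, y, e]) : ∃ (X Y : ℕ∞) (d' : Der (.eqconat X Y)),
      X' = X + 1 ∧ Y' = Y + 1 ∧ x = encConat X ∧ y = encConat Y ∧ e = d'.enc := by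
  have hs := d.shape
  rw [h] at hs
  generalize hD : mk .eqconat_1 [x, y, e] = D at hs
  cases hs with
  | eqconat_0 => simp at hD
  | eqconat_1 d' =>
    simp only [mk_inj, List.cons.injEq, true_and, and_true] at hD
    exact ⟨_, _, d', rfl, rfl, hD⟩

theorem Der.exists_of_enc_frombin_0 {N : Cobin} {Z' : ℕ∞} {d : Der (.frombin N Z')}
    {x y z e e' : ℕ → Tm Con} (h : d.enc = mk .frombin_0 [x, y, z, e, e']) :
    ∃ (X : Cobin) (Y Z : ℕ∞) (f : Der (.frombin X Y)) (p : Der (.coplus Y Y Z)),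
      N = X.b0 ∧ Z' = Z ∧ x = encCobin X ∧ y = encConat Y ∧ z = encConat Z ∧ e = f.enc ∧
        e' = p.enc := by
  have hs := d.shape
  rw [h] at hs
  generalize hD : mk .frombin_0 [x, y, z, e, e'] = D at hs
  cases hs with
  | frombin_1 => simp at hD
  | frombin_0 f p =>
    simp only [mk_inj, List.cons.injEq, true_and, and_true] at hD
    exact ⟨_, _, _, f, p, rfl, rfl, hD⟩

theorem Der.exists_of_enc_frombin_1 {N : Cobin} {Z' : ℕ∞} {d : Der (.frombin N Z')}
    {x y z e e' : ℕ → Tm Con} (h : d.enc = mk .frombin_1 [x, y, z, e, e']) :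
    ∃ (X : Cobin) (Y Z : ℕ∞) (f : Der (.frombin X Y)) (p : Der (.coplus Y Y Z)),
      N = X.b1 ∧ Z' = Z + 1 ∧ x = encCobin X ∧ y = encConat Y ∧ z = encConat Z ∧ e = f.enc ∧
        e' = p.enc := by
  have hs := d.shape
  rw [h] at hs
  generalize hD : mk .frombin_1 [x, y, z, e, e'] = D at hs
  cases hs with
  | frombin_0 => simp at hD
  | frombin_1 f p =>
    simp only [mk_inj, List.cons.injEq, true_and, and_true] at hD
    exact ⟨_, _, _, f, p, rfl, rfl, hD⟩

/-! ### Encodings of derivations of soundness -/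

/-- The encoding of a rule instance, given the encodings of the derivations of its premises. -/
def SRuleInst.enc (s : ℕ → ℕ → Tm Con) : SRuleInst → ℕ → Tm Con
  | .refl_0 => mk .eqconat_refl_0 []
  | .refl_1 X E => mk .eqconat_refl_1 [encConat X, E.enc, s 0]
  | .sound_0 N Y Z FN P E =>
      mk .bsucc_sound_0 [encCobin N, encConat Y, encConat Z, FN.enc, P.enc, E.enc, s 0]
  | .sound_1 N M CN CM FN FM S E PN PM =>
      mk .bsucc_sound_1 [encCobin N, encCobin M, encConat CN, encConat CM, FN.enc, FM.enc, S.enc,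
        E.enc, PN.enc, PM.enc, s 0]

theorem encSTree_eq {t : List ℕ → Option SRuleInst} {i : SRuleInst} (h : t [] = some i) :
    encSTree t = i.enc fun n => encSTree (subtree t n) := by
  funext k
  cases k with
  | zero => cases i <;> rfl
  | succ k => cases i <;> simp [encSTree, h, SRuleInst.enc, mk]

/-- Parameters now include derivations. Their numerical indices are identified first, so that the
derivations share a type and `Der.enc_injective` applies. -/
theorem SRuleInst.enc_inj {i i' : SRuleInst} {s s' : ℕ → ℕ → Tm Con}
    (h : i.enc s = i'.enc s') : i = i' ∧ ∀ n, (i.prems[n]?).isSome → s n = s' n := by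
  cases i <;> cases i' <;>
    simp only [SRuleInst.enc, mk_inj, List.cons.injEq, reduceCtorEq, false_and, and_true, true_and,
      encCobin_injective.eq_iff, encConat_injective.eq_iff] at h
  · exact ⟨rfl, by simp [SRuleInst.prems]⟩
  · obtain ⟨rfl, h1, h⟩ := h
    cases Der.enc_injective h1
    refine ⟨rfl, fun n hn => ?_⟩
    rcases n with _ | n <;> simp_all [SRuleInst.prems]
  · obtain ⟨rfl, rfl, rfl, h1, h2, h3, h⟩ := h
    cases Der.enc_injective h1
    cases Der.enc_injective h2
    cases Der.enc_injective h3
    refine ⟨rfl, fun n hn => ?_⟩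
    rcases n with _ | n <;> simp_all [SRuleInst.prems]
  · obtain ⟨rfl, rfl, rfl, rfl, h1, h2, h3, h4, h5, h6, h⟩ := h
    cases Der.enc_injective h1
    cases Der.enc_injective h2
    cases Der.enc_injective h3
    cases Der.enc_injective h4
    cases Der.enc_injective h5
    cases Der.enc_injective h6
    refine ⟨rfl, fun n hn => ?_⟩
    rcases n with _ | n <;> simp_all [SRuleInst.prems]

theorem SDer.node_eq_of_enc_eq {j j' : SJudg} {d : SDer j} {d' : SDer j'} (h : d.enc = d'.enc) :
    d.node = d'.node := by
  funext p
  induction p generalizing j j' with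
  | nil =>
    obtain ⟨i, hi, -⟩ := d.exists_root
    obtain ⟨i', hi', -⟩ := d'.exists_root
    rw [SDer.enc, SDer.enc, encSTree_eq hi, encSTree_eq hi'] at h
    rw [hi, hi', (SRuleInst.enc_inj h).1]
  | cons n p ih =>
    obtain ⟨i, hi, -⟩ := d.exists_root
    obtain ⟨i', hi', -⟩ := d'.exists_root
    rw [SDer.enc, SDer.enc, encSTree_eq hi, encSTree_eq hi'] at h
    obtain ⟨rfl, h'⟩ := SRuleInst.enc_inj h
    cases hn : (srules.prems i)[n]? with
    | none => rw [d.node_cons_eq_none hi hn, d'.node_cons_eq_none hi' hn]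
    | some j =>
      refine ih (d := d.sub hi n hn) (d' := d'.sub hi' n hn) (h' n ?_)
      exact Option.isSome_iff_exists.2 ⟨j, hn⟩

theorem SDer.enc_injective {j : SJudg} : Function.Injective (SDer.enc (j := j)) :=
  fun _ _ h => Deriv.ext (SDer.node_eq_of_enc_eq h)

/-- The form of the encoding of a derivation of soundness. -/
inductive SDer.Shape : SJudg → (ℕ → Tm Con) → Prop
  | mk (i : SRuleInst) (s : ℕ → ℕ → Tm Con)
      (h : ∀ n j, i.prems[n]? = some j → ∃ d : SDer j, s n = d.enc) : Shape i.concl (i.enc s)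

theorem SDer.shape {j : SJudg} (d : SDer j) : SDer.Shape j d.enc := by
  obtain ⟨i, hi, rfl⟩ := d.exists_root
  rw [SDer.enc, encSTree_eq hi]
  exact .mk i _ fun n j hn => ⟨d.sub hi n hn, rfl⟩

theorem SDer.isGround_enc {j : SJudg} (d : SDer j) : IsGround d.enc := by
  refine IsGround.coinduction (P := fun D => ∃ (j : SJudg) (d : SDer j), D = d.enc) ?_ ⟨j, d, rfl⟩
  rintro _ ⟨j, d, rfl⟩
  have hN := isGround_encCobin
  have hX := isGround_encConat
  have hD := @Der.isGround_enc
  have hs := d.shape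
  generalize d.enc = D at hs ⊢
  cases hs with
  | mk i s h =>
    cases i with
    | refl_0 => exact ⟨_, _, rfl, by simp⟩
    | refl_1 X E => exact ⟨_, _, rfl, by simpa [hX, hD] using .inl ⟨_, h 0 _ rfl⟩⟩
    | sound_0 => exact ⟨_, _, rfl, by simpa [hN, hX, hD] using .inl ⟨_, h 0 _ rfl⟩⟩
    | sound_1 => exact ⟨_, _, rfl, by simpa [hN, hX, hD] using .inl ⟨_, h 0 _ rfl⟩⟩

/-! ### Encodings are well-typed -/

/-- The type of `tobin_0` is the only one that mentions a recursion constant, namely `bzero`. Its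
family `tobin` plays no role in the terms considered. -/
theorem FO_conTy {c : Con} (h : c ≠ .tobin_0) : (conTy c).FO := by
  cases c <;> first | exact absurd rfl h | simp [conTy, Ty.FO, FSpine.FO, FTm.FO, FSpine.ofList]

theorem typedAt_encCobin (k : ℕ) (N : Cobin) : TypedAt sig k .cobin [] (encCobin N) := by
  induction k generalizing N with
  | zero => exact TypedAt.zero _ _ _
  | succ k ih =>
    rcases N.cases with ⟨X, rfl⟩ | ⟨X, rfl⟩
    all_goals
      simp only [encCobin_b0, encCobin_b1]
      rw [typedAt_succ (FO_conTy (by simp)) (by simp) (by simp [isGround_encCobin])]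
      simp [conTy, MatchAt, FSpine.inst, FSpine.ofList, ih]

theorem typedAt_encConat (k : ℕ) (X : ℕ∞) : TypedAt sig k .conat [] (encConat X) := by
  induction k generalizing X with
  | zero => exact TypedAt.zero _ _ _
  | succ k ih =>
    rcases conat_cases X with rfl | ⟨X, rfl⟩
    all_goals
      simp only [encConat_zero, encConat_succ]
      rw [typedAt_succ (FO_conTy (by simp)) (by simp) (by simp [isGround_encConat])]
      simp [conTy, MatchAt, FSpine.inst, FSpine.ofList, ih]

theorem can_encCobin (N : Cobin) : Can .cobin [] (encCobin N) :=
  ⟨isGround_encCobin N, fun k => typedAt_encCobin k N⟩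

theorem can_encConat (X : ℕ∞) : Can .conat [] (encConat X) :=
  ⟨isGround_encConat X, fun k => typedAt_encConat k X⟩

/-- The type family that encodes a judgment. -/
def Judg.fam : Judg → Fam
  | .bsucc _ _ => .bsucc
  | .coplus _ _ _ => .coplus
  | .frombin _ _ => .frombin
  | .eqconat _ _ => .eqconat

/-- The encodings of the arguments of a judgment. -/
def Judg.args : Judg → List (ℕ → Tm Con)
  | .bsucc N M => [encCobin N, encCobin M]
  | .coplus X Y Z => [encConat X, encConat Y, encConat Z]
  | .frombin N X => [encCobin N, encConat X]
  | .eqconat X Y => [encConat X, encConat Y]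

theorem Judg.isGround_args (j : Judg) : ∀ T ∈ j.args, IsGround T := by
  cases j <;> simp [Judg.args, isGround_encCobin, isGround_encConat]

theorem Der.typedAt_enc (k : ℕ) {j : Judg} (d : Der j) : TypedAt sig k j.fam j.args d.enc := by
  induction k generalizing j with
  | zero => exact TypedAt.zero _ _ _
  | succ k ih =>
    have hN := typedAt_encCobin k
    have hX := typedAt_encConat k
    have hs := d.shape
    generalize d.enc = D at hs ⊢
    clear d
    cases hs <;>
      rw [typedAt_succ (FO_conTy (by simp)) (Judg.isGround_args _)
        (by simp [isGround_encCobin, isGround_encConat, Der.isGround_enc])] <;>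
      simp [conTy, MatchAt, FSpine.inst, FTm.inst, FSpine.ofList, env, Judg.fam, Judg.args, hN, hX]
    case bsucc_1 d => exact ih d
    case coplus_1 d => exact ih d
    case frombin_0 d d' => exact ⟨ih d, ih d'⟩
    case frombin_1 d d' => exact ⟨ih d, ih d'⟩
    case eqconat_1 d => exact ih d

theorem Der.can_enc {j : Judg} (d : Der j) : Can j.fam j.args d.enc :=
  ⟨d.isGround_enc, fun k => d.typedAt_enc k⟩

/-- The type family that encodes a judgment. -/
def SJudg.fam : SJudg → Fam
  | .refl _ _ => .eqconat_refl
  | .sound _ _ _ _ _ _ _ _ => .bsucc_sound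

/-- The encodings of the arguments of a judgment. -/
def SJudg.args : SJudg → List (ℕ → Tm Con)
  | .refl X E => [encConat X, E.enc]
  | .sound N M CN CM FN FM S E =>
      [encCobin N, encCobin M, encConat CN, encConat CM, FN.enc, FM.enc, S.enc, E.enc]

theorem SJudg.isGround_args (j : SJudg) : ∀ T ∈ j.args, IsGround T := by
  cases j <;> simp [SJudg.args, isGround_encCobin, isGround_encConat, Der.isGround_enc]

theorem SDer.typedAt_enc (k : ℕ) {j : SJudg} (d : SDer j) : TypedAt sig k j.fam j.args d.enc := by
  induction k generalizing j with
  | zero => exact TypedAt.zero _ _ _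
  | succ k ih =>
    have hN := typedAt_encCobin k
    have hX := typedAt_encConat k
    have hD := @Der.typedAt_enc k
    have hs := d.shape
    generalize d.enc = D at hs ⊢
    cases hs with
    | mk i s h =>
      -- No rule here has more than one premise, so position `0` suffices.
      have h0 : ∀ j, i.prems[0]? = some j → IsGround (s 0) ∧ TypedAt sig k j.fam j.args (s 0) := by
        intro j hj
        obtain ⟨d, hd⟩ := h 0 j hj
        rw [hd]
        exact ⟨d.isGround_enc, ih d⟩
      cases i with
      | refl_0 =>
        rw [SRuleInst.enc, typedAt_succ (FO_conTy (by simp)) (SJudg.isGround_args _) (by simp)]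
        simp [conTy, MatchAt, FSpine.inst, FTm.inst, FSpine.ofList, SJudg.fam, SJudg.args,
          SRuleInst.concl]
      | refl_1 X E =>
        have h0 := h0 _ rfl
        rw [SRuleInst.enc, typedAt_succ (FO_conTy (by simp)) (SJudg.isGround_args _)
          (by simp [isGround_encConat, Der.isGround_enc, h0])]
        simp [conTy, MatchAt, FSpine.inst, FTm.inst, FSpine.ofList, env, SJudg.fam, SJudg.args,
          SRuleInst.concl, hX]
        exact ⟨hD E, h0.2⟩
      | sound_0 N Y Z FN P E =>
        have h0 := h0 _ rfl
        rw [SRuleInst.enc, typedAt_succ (FO_conTy (by simp)) (SJudg.isGround_args _)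
          (by simp [isGround_encCobin, isGround_encConat, Der.isGround_enc, h0])]
        simp [conTy, MatchAt, FSpine.inst, FTm.inst, FSpine.ofList, env, SJudg.fam, SJudg.args,
          SRuleInst.concl, hX, hN]
        exact ⟨hD FN, hD P, hD E, h0.2⟩
      | sound_1 N M CN CM FN FM S E PN PM =>
        have h0 := h0 _ rfl
        rw [SRuleInst.enc, typedAt_succ (FO_conTy (by simp)) (SJudg.isGround_args _)
          (by simp [isGround_encCobin, isGround_encConat, Der.isGround_enc, h0])]
        simp [conTy, MatchAt, FSpine.inst, FTm.inst, FSpine.ofList, env, SJudg.fam, SJudg.args,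
          SRuleInst.concl, hX, hN]
        -- Successors in the index types are folded back, so that they become the encoded arguments
        -- of the judgments of `E` and `PM`.
        simp only [← encConat_succ]
        exact ⟨hD FN, hD FM, hD S, hD E, hD PN, hD PM, h0.2⟩

theorem SDer.can_enc {j : SJudg} (d : SDer j) : Can j.fam j.args d.enc :=
  ⟨d.isGround_enc, fun k => d.typedAt_enc k⟩

/-! ### Canonical terms of type `cobin` -/

theorem Can.exists_cobin {D : ℕ → Tm Con} (h : Can .cobin [] D) :
    ∃ (b : Bool) (D' : ℕ → Tm Con), Can .cobin [] D' ∧ D = CoLF.mk (if b then .b1 else .b0) [D'] := by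
  obtain ⟨c, Ms, rfl, hMs, ht, hm⟩ := h.exists_matches (by simp)
    (fun c hc => FO_conTy (by rintro rfl; simp [conTy, Ty.target] at hc))
  cases c <;> simp only [conTy, Ty.target, List.foldr, reduceCtorEq] at ht
  all_goals
    simp only [conTy, Matches, FSpine.inst, FSpine.ofList, List.foldr] at hm
    obtain ⟨D', _, rfl, hD', rfl, -⟩ := hm
  · exact ⟨false, D', ⟨hMs D' (by simp), hD'⟩, rfl⟩
  · exact ⟨true, D', ⟨hMs D' (by simp), hD'⟩, rfl⟩

/-- Corecursion on canonical terms: emit the digit at the head and continue with its argument. The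
resulting stream encodes to the given term, by induction on the depth. -/
theorem Can.exists_encCobin {D : ℕ → Tm Con} (h : Can .cobin [] D) : ∃ N, encCobin N = D := by
  choose bit next hn he using fun s : {D // Can .cobin [] D} => s.2.exists_cobin
  let g : {D // Can .cobin [] D} → Cobin := Stream'.corec bit fun s => ⟨next s, hn s⟩
  have hg : ∀ s, g s = Stream'.cons (bit s) (g ⟨next s, hn s⟩) := fun s => Stream'.corec_eq _ _ _
  refine ⟨g ⟨D, h⟩, funext fun k => ?_⟩
  suffices ∀ s : {D // Can .cobin [] D}, encCobin (g s) k = s.1 k from this ⟨D, h⟩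
  induction k with
  | zero => exact fun s => s.2.ground.zero.symm
  | succ k ih =>
    intro s
    rw [encCobin_eq, he s, hg s, Stream'.head_cons, Stream'.tail_cons]
    simp [CoLF.mk, ih]

/-! ### Canonical terms of type `bsucc` -/

/-- A leading `0` absorbs the carry. -/
theorem Cobin.succ_b0 (X : Cobin) : Cobin.succ X.b0 = X.b1 := by
  apply Stream'.ext
  rintro (_ | n)
  · rfl
  · have : ¬ ∀ j < n + 1, Stream'.get X.b0 j = true := fun h => by
      simpa using h 0 (Nat.succ_pos n)
    change xor (X.get n) (decide (∀ j < n + 1, Stream'.get X.b0 j = true)) = X.get n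
    rw [decide_eq_false this, Bool.xor_false]

/-- A leading `1` passes the carry on to the tail. -/
theorem Cobin.succ_b1 (X : Cobin) : Cobin.succ X.b1 = (Cobin.succ X).b0 := by
  apply Stream'.ext
  rintro (_ | n)
  · rfl
  · have : (∀ j < n + 1, Stream'.get X.b1 j = true) ↔ ∀ j < n, X.get j = true := by
      constructor
      · intro h j hj
        exact h (j + 1) (by omega)
      · rintro h (_ | j) hj
        · rfl
        · exact h j (by omega)
    change xor (X.get n) (decide (∀ j < n + 1, Stream'.get X.b1 j = true)) =
      xor (X.get n) (decide (∀ j < n, X.get j = true))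
    simp only [this]

theorem Can.bsucc_cases {N M : Cobin} {D : ℕ → Tm Con}
    (h : Can .bsucc [encCobin N, encCobin M] D) :
    (∃ X : Cobin, N = X.b0 ∧ M = X.b1) ∨
      ∃ (X Y : Cobin) (D' : ℕ → Tm Con), N = X.b1 ∧ M = Y.b0 ∧
        Can .bsucc [encCobin X, encCobin Y] D' := by
  obtain ⟨c, Ms, rfl, hMs, ht, hm⟩ := h.exists_matches (by simp [isGround_encCobin])
    (fun c hc => FO_conTy (by rintro rfl; simp [conTy, Ty.target] at hc))
  cases c <;> simp only [conTy, Ty.target, List.foldr, reduceCtorEq] at ht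
  all_goals
    simp only [conTy, Matches, FSpine.inst, FTm.inst, FSpine.ofList, List.foldr] at hm
  · obtain ⟨x, _, rfl, -, rfl, -, hm⟩ := hm
    left
    rcases N.cases with ⟨X, rfl⟩ | ⟨X, rfl⟩ <;> rcases M.cases with ⟨Y, rfl⟩ | ⟨Y, rfl⟩ <;>
      simp [env] at hm
    obtain ⟨rfl, h⟩ := hm
    -- The same variable instantiates both tails in the result type of `bsucc_0`, so the tails
    -- agree.
    rw [encCobin_injective h]
    exact ⟨Y, rfl, rfl⟩
  · obtain ⟨x, _, rfl, -, y, _, rfl, -, e, _, rfl, he, rfl, -, hm⟩ := hm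
    right
    rcases N.cases with ⟨X, rfl⟩ | ⟨X, rfl⟩ <;> rcases M.cases with ⟨Y, rfl⟩ | ⟨Y, rfl⟩ <;>
      simp [env] at hm
    obtain ⟨rfl, rfl⟩ := hm
    exact ⟨X, Y, e, rfl, rfl, hMs e (by simp), he⟩

/-- Comparing one bit at a time needs only finitely many inversions, so an infinite chain of carries
causes no difficulty. -/
theorem Can.eq_succ {N M : Cobin} {D : ℕ → Tm Con}
    (h : Can .bsucc [encCobin N, encCobin M] D) : M = N.succ := by
  apply Stream'.ext
  intro n
  induction n generalizing N M D with
  | zero =>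
    rcases h.bsucc_cases with ⟨X, rfl, rfl⟩ | ⟨X, Y, D', rfl, rfl, h'⟩
    · rw [Cobin.succ_b0]
    · rw [Cobin.succ_b1]; rfl
  | succ n ih =>
    rcases h.bsucc_cases with ⟨X, rfl, rfl⟩ | ⟨X, Y, D', rfl, rfl, h'⟩
    · rw [Cobin.succ_b0]
    · rw [Cobin.succ_b1]; exact ih h'

/-- The canonical term of type `bsucc ⌜N⌝ ⌜N.succ⌝`. -/
def succTm (N : Cobin) : ℕ → Tm Con
  | 0 => .unobs
  | k + 1 =>
    if N.head then node .bsucc_1 [encCobin N.tail k, encCobin (Cobin.succ N.tail) k, succTm N.tail k]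
    else node .bsucc_0 [encCobin N.tail k]

theorem succTm_b0 (X : Cobin) : succTm X.b0 = mk .bsucc_0 [encCobin X] := by
  funext k; cases k <;> rfl

theorem succTm_b1 (X : Cobin) :
    succTm X.b1 = mk .bsucc_1 [encCobin X, encCobin X.succ, succTm X] := by
  funext k; cases k <;> rfl

theorem isGround_succTm (N : Cobin) : IsGround (succTm N) := by
  refine IsGround.coinduction (P := fun D => ∃ N, D = succTm N) ?_ ⟨N, rfl⟩
  rintro _ ⟨N, rfl⟩
  rcases N.cases with ⟨X, rfl⟩ | ⟨X, rfl⟩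
  · exact ⟨_, _, succTm_b0 X, by simp [isGround_encCobin]⟩
  · exact ⟨_, _, succTm_b1 X, by simp [isGround_encCobin]⟩

theorem can_succTm (N : Cobin) : Can .bsucc [encCobin N, encCobin N.succ] (succTm N) := by
  refine ⟨isGround_succTm N, fun k => ?_⟩
  induction k generalizing N with
  | zero => exact TypedAt.zero _ _ _
  | succ k ih =>
    rcases N.cases with ⟨X, rfl⟩ | ⟨X, rfl⟩
    · rw [succTm_b0, typedAt_succ (FO_conTy (by simp)) (by simp [isGround_encCobin, -encCobin_b0])
        (by simp [isGround_encCobin])]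
      simp [conTy, MatchAt, FSpine.inst, FTm.inst, FSpine.ofList, env, Cobin.succ_b0,
        typedAt_encCobin]
    · rw [succTm_b1, typedAt_succ (FO_conTy (by simp)) (by simp [isGround_encCobin, -encCobin_b1])
        (by simp [isGround_encCobin, isGround_succTm])]
      simpa [conTy, MatchAt, FSpine.inst, FTm.inst, FSpine.ofList, env, Cobin.succ_b1,
        typedAt_encCobin] using ih X

/-! ### Canonical terms of type `eqconat/refl` and `bsucc_sound` -/

/-- The two derivations have different types until the numbers are identified; comparing their
encodings avoids heterogeneous equality. -/
theorem SJudg.refl_congr {X X' : ℕ∞} {E : Der (.eqconat X X)} {E' : Der (.eqconat X' X')}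
    (hX : X = X') (hE : E.enc = E'.enc) : SJudg.refl X E = SJudg.refl X' E' := by
  subst hX
  rw [Der.enc_injective hE]

theorem SJudg.sound_congr {N N' M M' : Cobin} {CN CN' CM CM' : ℕ∞}
    {FN : Der (.frombin N CN)} {FN' : Der (.frombin N' CN')}
    {FM : Der (.frombin M CM)} {FM' : Der (.frombin M' CM')}
    {S : Der (.bsucc N M)} {S' : Der (.bsucc N' M')}
    {E : Der (.eqconat (CN + 1) CM)} {E' : Der (.eqconat (CN' + 1) CM')}
    (hN : N = N') (hM : M = M') (hCN : CN = CN') (hCM : CM = CM') (hFN : FN.enc = FN'.enc)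
    (hFM : FM.enc = FM'.enc) (hS : S.enc = S'.enc) (hE : E.enc = E'.enc) :
    SJudg.sound N M CN CM FN FM S E = SJudg.sound N' M' CN' CM' FN' FM' S' E' := by
  subst hN hM hCN hCM
  rw [Der.enc_injective hFN, Der.enc_injective hFM, Der.enc_injective hS, Der.enc_injective hE]

theorem forall_getElem?_singleton {α : Type} {P : ℕ → α → Prop} {a : α} (h : P 0 a) :
    ∀ n b, [a][n]? = some b → P n b := by
  rintro (_ | n) b hb
  · simp only [List.getElem?_cons_zero, Option.some.injEq] at hb
    exact hb ▸ h
  · simp at hb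

theorem Can.exists_refl {X : ℕ∞} {E : Der (.eqconat X X)} {D : ℕ → Tm Con}
    (h : Can .eqconat_refl [encConat X, E.enc] D) :
    ∃ (i : SRuleInst) (s : ℕ → ℕ → Tm Con), i.concl = .refl X E ∧ D = i.enc s ∧
      ∀ n j, i.prems[n]? = some j → Can j.fam j.args (s n) := by
  obtain ⟨c, Ms, rfl, hMs, ht, hm⟩ := h.exists_matches (SJudg.isGround_args (.refl X E))
    (fun c hc => FO_conTy (by rintro rfl; simp [conTy, Ty.target] at hc))
  cases c <;> simp only [conTy, Ty.target, List.foldr, reduceCtorEq] at ht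
  all_goals
    simp only [conTy, Matches, FSpine.inst, FTm.inst, FSpine.ofList, List.foldr] at hm
  · obtain ⟨rfl, -, hm⟩ := hm
    simp only [List.cons.injEq, and_true] at hm
    -- The axiom has no premise, so the family of subterms is arbitrary.
    refine ⟨.refl_0, fun _ _ => .unobs, SJudg.refl_congr ?_ ?_, rfl, by simp [SRuleInst.prems]⟩
    · apply encConat_injective; rw [encConat_zero, hm.1]
    · rw [Der.enc_eqconat_0, hm.2]
  · obtain ⟨x, _, rfl, -, e, _, rfl, -, d, _, rfl, hd, rfl, -, hm⟩ := hm
    simp [env] at hm hd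
    obtain ⟨h1, h2⟩ := hm
    obtain ⟨X', Y', E', rfl, hY, rfl, h3, rfl⟩ := Der.exists_of_enc_eqconat_1 h2.symm
    -- Both numerical arguments of `eqconat_1` are the same instantiated variable, so the premise is
    -- again reflexive.
    obtain rfl := encConat_injective h3
    refine ⟨.refl_1 X' E', fun _ => d, SJudg.refl_congr rfl ?_, rfl,
      forall_getElem?_singleton ⟨hMs d (by simp), hd⟩⟩
    rw [Der.enc_eqconat_1, h2]

/-- The indices `FN`, `FM`, `S` and `E` jointly contain every non-recursive argument of the
constructor. Inverting them turns the matched term into a rule instance; the remaining index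
equations are exactly the agreement of its conclusion with the given judgment. -/
theorem Can.exists_sound {N M : Cobin} {CN CM : ℕ∞} {FN : Der (.frombin N CN)}
    {FM : Der (.frombin M CM)} {S : Der (.bsucc N M)} {E : Der (.eqconat (CN + 1) CM)}
    {D : ℕ → Tm Con}
    (h : Can .bsucc_sound [encCobin N, encCobin M, encConat CN, encConat CM,
      FN.enc, FM.enc, S.enc, E.enc] D) :
    ∃ (i : SRuleInst) (s : ℕ → ℕ → Tm Con), i.concl = .sound N M CN CM FN FM S E ∧ D = i.enc s ∧
      ∀ n j, i.prems[n]? = some j → Can j.fam j.args (s n) := by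
  obtain ⟨c, Ms, rfl, hMs, ht, hm⟩ :=
    h.exists_matches (SJudg.isGround_args (.sound N M CN CM FN FM S E))
    (fun c hc => FO_conTy (by rintro rfl; simp [conTy, Ty.target] at hc))
  cases c <;> simp only [conTy, Ty.target, List.foldr, reduceCtorEq] at ht
  all_goals
    simp only [conTy, Matches, FSpine.inst, FTm.inst, FSpine.ofList, List.foldr] at hm
  · obtain ⟨n, _, rfl, -, y, _, rfl, -, z, _, rfl, -, fb, _, rfl, -, cp, _, rfl, -, eqc, _, rfl, -,
      d, _, rfl, hd, rfl, -, hm⟩ := hm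
    simp [env] at hm hd
    obtain ⟨h1, h2, h3, h4, h5, h6, h7, h8⟩ := hm
    -- `FN` supplies all arguments except the equality derivation, which comes from `E`.
    obtain ⟨N', Y, Z, F, P, rfl, rfl, rfl, rfl, rfl, rfl, rfl⟩ :=
      Der.exists_of_enc_frombin_0 h5.symm
    obtain ⟨Z₁, Z₂, E', h9, rfl, h10, h11, rfl⟩ := Der.exists_of_enc_eqconat_1 h8.symm
    obtain rfl := encConat_injective h10
    obtain rfl := encConat_injective h11
    refine ⟨.sound_0 N' Y CN F P E', fun _ => d,
      SJudg.sound_congr rfl ?_ rfl rfl ?_ ?_ ?_ ?_, rfl,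
      forall_getElem?_singleton ⟨hMs d (by simp), hd⟩⟩
    · apply encCobin_injective; rw [encCobin_b1, h2]
    · rw [Der.enc_frombin_0, h5]
    · rw [Der.enc_frombin_1, h6]
    · rw [Der.enc_bsucc_0, h7]
    · rw [Der.enc_eqconat_1, h8]
  · obtain ⟨n, _, rfl, -, m, _, rfl, -, x, _, rfl, -, y, _, rfl, -, fn, _, rfl, -, fm, _, rfl, -,
      sn, _, rfl, -, eqc, _, rfl, -, pn, _, rfl, -, pm, _, rfl, -, d, _, rfl, hd, rfl, -, hm⟩ := hm
    simp [env] at hm hd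
    obtain ⟨h1, h2, h3, h4, h5, h6, h7, h8⟩ := hm
    obtain ⟨N', X, Z, F, P, rfl, rfl, rfl, rfl, h9, rfl, rfl⟩ :=
      Der.exists_of_enc_frombin_1 h5.symm
    -- The index repeats `CN` as the doubled value, so `P` derives that `CN` plus itself is `CN`.
    obtain rfl := encConat_injective h9
    obtain ⟨M', Y, Z, F', P', rfl, rfl, rfl, rfl, h10, rfl, rfl⟩ :=
      Der.exists_of_enc_frombin_0 h6.symm
    -- Here the doubled value is the successor of `CM`, as `PM` requires.
    rw [← encConat_succ] at h10
    obtain rfl := encConat_injective h10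
    obtain ⟨N₁, M₁, S', h11, h12, h13, h14, rfl⟩ := Der.exists_of_enc_bsucc_1 h7.symm
    obtain rfl := encCobin_injective h13
    obtain rfl := encCobin_injective h14
    obtain ⟨X₁, Y₁, E', h15, h16, h17, h18, rfl⟩ := Der.exists_of_enc_eqconat_1 h8.symm
    rw [← encConat_succ] at h17
    obtain rfl := encConat_injective h17
    obtain rfl := encConat_injective h18
    refine ⟨.sound_1 N' M' X Y F F' S' E' P P', fun _ => d,
      SJudg.sound_congr rfl rfl rfl rfl ?_ ?_ ?_ ?_, rfl,
      forall_getElem?_singleton ⟨hMs d (by simp), hd⟩⟩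
    · rw [Der.enc_frombin_1, h5]
    · rw [Der.enc_frombin_0, encConat_succ, h6]
    · rw [Der.enc_bsucc_1, h7]
    · rw [Der.enc_eqconat_1, encConat_succ, h8]

-- Unfolding canonical terms into derivations

theorem Can.exists_step {j : SJudg} {D : ℕ → Tm Con} (h : Can j.fam j.args D) :
    ∃ (i : SRuleInst) (s : ℕ → ℕ → Tm Con), i.concl = j ∧ D = i.enc s ∧
      ∀ n j', i.prems[n]? = some j' → Can j'.fam j'.args (s n) := by
  cases j with
  | refl X E => exact Can.exists_refl h
  | sound N M CN CM FN FM S E => exact Can.exists_sound h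

/-- Guardedness: an observation of depth `k + 1` sees the subterms at premises only to depth `k`. -/
theorem SRuleInst.enc_congr {i : SRuleInst} {s s' : ℕ → ℕ → Tm Con} {k : ℕ}
    (h : ∀ n, (i.prems[n]?).isSome → s n k = s' n k) : i.enc s (k + 1) = i.enc s' (k + 1) := by
  cases i
  · rfl
  all_goals
    have := h 0 rfl
    simp [SRuleInst.enc, mk, this]

/-- States are judgments paired with a canonical term of the corresponding type. Inversion chooses a
rule instance and a successor state for each premise, and the derivation is the unfolding of this
system. That it encodes to the given term follows by induction on the depth, for all states at once.
-/
theorem Can.exists_sDer {j : SJudg} {D : ℕ → Tm Con} (h : Can j.fam j.args D) :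
    ∃ d : SDer j, d.enc = D := by
  let St := {x : SJudg × (ℕ → Tm Con) // Can x.1.fam x.1.args x.2}
  choose inst sub hc he hs using fun s : St => s.2.exists_step
  let next : St → ℕ → Option St := fun s n =>
    if h : n < (inst s).prems.length then
      some ⟨((inst s).prems[n], sub s n), hs s n _ (List.getElem?_eq_getElem h)⟩
    else none
  have hp : ∀ s n, (next s n).map (fun s => s.1.1) = (srules.prems (inst s))[n]? := by
    intro s n
    by_cases h : n < (inst s).prems.length
    · simp only [next, h, dif_pos, Option.map_some]
      exact (List.getElem?_eq_getElem h).symm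
    · simp only [next, h, dif_neg, not_false_eq_true, Option.map_none]
      exact (List.getElem?_eq_none (not_lt.1 h)).symm
  let d : ∀ s : St, SDer s.1.1 := Deriv.unfold (R := srules) inst next (fun s => s.1.1) hc hp
  refine ⟨d ⟨(j, D), h⟩, funext fun k => ?_⟩
  suffices ∀ s : St, (d s).enc k = s.1.2 k from this ⟨(j, D), h⟩
  induction k with
  | zero => exact fun s => s.2.ground.zero.symm
  | succ k ih =>
    intro s
    rw [he s]
    refine (congrFun (encSTree_eq (t := (d s).node) (i := inst s) rfl) (k + 1)).trans ?_
    apply SRuleInst.enc_congr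
    intro n hn
    have hn' : n < (inst s).prems.length := by simpa using hn
    -- The subtree of an unfolding is the unfolding of the successor state.
    have : subtree (d s).node n =
        (d ⟨((inst s).prems[n], sub s n), hs s n _ (List.getElem?_eq_getElem hn')⟩).node := by
      funext p
      change (next s n).bind _ = _
      simp only [next, hn', dif_pos, Option.bind_some]
      rfl
    exact (congrArg (encSTree · k) this).trans (ih _)

end CoLF

-- Adequacy of the encoding

theorem mainTheorem12 :
    -- canonical terms of type `cobin` and cobinary numbers
    Set.BijOn CoLF.encCobin Set.univ {D | CoLF.sig.Canonical .cobin [] D} ∧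
    -- `bsucc` is the successor relation
    (∀ N M : CoLF.Cobin,
      (∃ D, CoLF.sig.Canonical .bsucc [CoLF.encCobin N, CoLF.encCobin M] D) ↔ M = N.succ) ∧
    -- canonical terms of every instance of `bsucc_sound`, and derivations
    (∀ (N M : CoLF.Cobin) (CN CM : ℕ∞)
      (FN : CoLF.Der (.frombin N CN)) (FM : CoLF.Der (.frombin M CM))
      (S : CoLF.Der (.bsucc N M)) (E : CoLF.Der (.eqconat (CN + 1) CM)),
      (CoLF.sig.Canonical .conat [] (CoLF.encConat CN) ∧
        CoLF.sig.Canonical .conat [] (CoLF.encConat CM) ∧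
        CoLF.sig.Canonical .frombin [CoLF.encCobin N, CoLF.encConat CN] FN.enc ∧
        CoLF.sig.Canonical .frombin [CoLF.encCobin M, CoLF.encConat CM] FM.enc ∧
        CoLF.sig.Canonical .bsucc [CoLF.encCobin N, CoLF.encCobin M] S.enc ∧
        CoLF.sig.Canonical .eqconat [CoLF.encConat (CN + 1), CoLF.encConat CM] E.enc) ∧
      Set.BijOn (CoLF.SDer.enc (j := .sound N M CN CM FN FM S E)) Set.univ
        {D | CoLF.sig.Canonical .bsucc_sound
          [CoLF.encCobin N, CoLF.encCobin M, CoLF.encConat CN, CoLF.encConat CM,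
            FN.enc, FM.enc, S.enc, E.enc] D}) := by
  simp only [CoLF.canonical_iff]
  refine ⟨⟨fun N _ => CoLF.can_encCobin N, CoLF.encCobin_injective.injOn, fun D hD => ?_⟩,
    fun N M => ⟨fun ⟨D, hD⟩ => hD.eq_succ, ?_⟩, fun N M CN CM FN FM S E =>
    ⟨⟨CoLF.can_encConat CN, CoLF.can_encConat CM, FN.can_enc, FM.can_enc, S.can_enc, E.can_enc⟩,
      fun d _ => CoLF.SDer.can_enc d, CoLF.SDer.enc_injective.injOn, fun D hD => ?_⟩⟩
  · obtain ⟨N, hN⟩ := CoLF.Can.exists_encCobin hD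
    exact ⟨N, trivial, hN⟩
  · rintro rfl
    exact ⟨_, CoLF.can_succTm N⟩
  · obtain ⟨d, hd⟩ := CoLF.Can.exists_sDer (j := .sound N M CN CM FN FM S E) hD
    exact ⟨d, trivial, hd⟩
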